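/- **Theorem 4.3 (Sparse core-set).** There are absolute constants $C, K > 0$ and $n_0 \in \mathbb{N}$ such that the following holds for all $n \ge n_0$, $\delta > 0$ and $0 < \varepsilon < 1$. *Setting.* Either (MaxCut) $G = (V,E)$ is an unweighted simple graph with $|V| = n$, and we put $\omega_e = 1$ for $e\in E$; or (correlation clustering) $G = (V, E, c^+, c^-)$ is a simple graph with $|V| = n$ and edge weights $c^+_e, c^-_e \in [0,1]$, at most one of which is nonzero for every edge $e$, and we put $\omega_e = |c^+_e - c^-_e|$. Let $d_i = \sum_{e \ni i} \omega_e$ be the degree of $i$ and suppose that the average degree $\Delta = \frac1n \sum_i d_i$ equals $n^{\delta}$. Let $\alpha = \frac{\varepsilon^4}{C \log n}$ for MaxCut and $\alpha = \frac{\varepsilon^8}{C\log n}$ for correlation clustering, let $$h_i = \min\Big\{1, \frac{\max\{d_i, \varepsilon\Delta\}}{\Delta^2 \alpha}\Big\},$$ and let $p_i \in [h_i, 2h_i]$ with $p_i \le 1$ be given for every $i \in V$. *Vertex sampling.* Choose a random set $S' \subseteq V$ containing every $i$ independently with probability $p_i$. Let $H$ be the subgraph of $G$ induced on $S'$, in which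 the weight of an edge $ij$ (that is, $1$ for MaxCut, and both $c^+_{ij}$ and $c^-_{ij}$ for correlation clustering) is multiplied by $\frac{1}{p_i p_j \Delta^2}$. *Edge sampling.* Let $w_e$ be the weight of the edge $e$ in $H$ (for correlation clustering, the absolute value of the difference of its two weights) and $W = \sum_{e \in E(H)} w_e$. Given $S'$, keep every edge $e$ of $H$ independently with probability $p_e = \min\big(1, \frac{8 |S'| w_e}{\varepsilon^2 W}\big)$, and divide the weight(s) of every kept edge by $p_e$. Let $H'$ be the resulting graph on the vertex set $S'$. *Conclusion.* Write $\mathrm{MaxCut}(\cdot)$ for the maximum total weight of the edges across a bipartition of the vertices, and $CC(\cdot)$ for the maximum over all partitions of the vertices into clusters of the sum of $c^+_e$ over the edges inside clusters plus the sum of $c^-_e$ over the edges between clusters. With probability at least $1 - \frac{1}{n^2}$, the graph $H'$ is an $\varepsilon$-core-set of $G$ of size $\widetilde O(n/\Delta) = \widetilde O(n^{1-\delta})$. Precisely, with probability at least $1-\frac1{n^2}$, both of the following hold: - for MaxCut, $$\frac{\mathrm{MaxCut}(G)}{1+\varepsilon} \le \Delta^2\, \mathrm{MaxCut}(H') \le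 (1+\varepsilon)\,\mathrm{MaxCut}(G) \quad\text{and}\quad |V(H')| + |E(H')| \le \frac{K}{\varepsilon^{6}} \cdot \log n \cdot \frac{n}{\Delta};$$ - for correlation clustering (with its own $\alpha$), $$\frac{CC(G)}{1+\varepsilon} \le \Delta^2\, CC(H') \le (1+\varepsilon)\, CC(G) \quad\text{and}\quad |V(H')| + |E(H')| \le \frac{K}{\varepsilon^{10}} \cdot \log n \cdot \frac{n}{\Delta};$$ where $\frac{n}{\Delta} = n^{1-\delta}$. -/

import Mathlib

open scoped Classical in
/-- The law of a random subset of `U` that contains every `i ∈ U` independently with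
probability `p i`: the probability that the random subset is equal to `A ⊆ U`. -/
noncomputable def bernoulliMass {ι : Type*} (U : Finset ι) (p : ι → ℝ) (A : Finset ι) : ℝ :=
  (∏ i ∈ A, p i) * ∏ i ∈ U \ A, (1 - p i)

theorem sum_bernoulliMass {ι : Type*} (U : Finset ι) (p : ι → ℝ) :
    ∑ A ∈ U.powerset, bernoulliMass U p A = 1 := by
  classical
  have h := Finset.prod_add p (fun i => 1 - p i) U
  simp only [add_sub_cancel, Finset.prod_const_one] at h
  rw [h]
  refine Finset.sum_congr rfl fun A _ => ?_
  unfold bernoulliMass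
  congr!

open scoped Classical in
/-- The edges in `E` that have both end points in `S`. -/
noncomputable def edgesWithin {V : Type*} (E : Finset (Sym2 V)) (S : Finset V) :
    Finset (Sym2 V) :=
  E.filter fun e => ∀ v ∈ e, v ∈ S

open scoped Classical in
/-- The probability of an event about the outcome `(S, F)` of two-stage sampling: first a set
`S` of vertices is drawn, containing every vertex `v` independently with probability `p v`; then,
given `S`, a set `F` of edges is drawn among the edges of `E` inside `S`, containing every such
edge `e` independently with probability `pe S e`. -/
noncomputable def twoStageProb {V : Type*} [Fintype V] (E : Finset (Sym2 V)) (p : V → ℝ)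
    (pe : Finset V → Sym2 V → ℝ) (event : Finset V → Finset (Sym2 V) → Prop) : ℝ :=
  ∑ S ∈ (Finset.univ : Finset V).powerset, bernoulliMass Finset.univ p S *
    ∑ F ∈ (edgesWithin E S).powerset, bernoulliMass (edgesWithin E S) (pe S) F *
      (if event S F then 1 else 0)

/-- The factor `1 / (p i * p j * Δ ^ 2)` by which vertex sampling multiplies the weight of the
edge `ij`. -/
noncomputable def vertexScale {V : Type*} (p : V → ℝ) (Δ : ℝ) (e : Sym2 V) : ℝ :=
  1 / ((e.map p).mul * Δ ^ 2)

/-- The importance score of a vertex of degree `d` in a graph of average degree `Δ`. -/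
noncomputable def importanceScore (ε α Δ d : ℝ) : ℝ :=
  min 1 (max d (ε * Δ) / (Δ ^ 2 * α))

/-- `x` is within a factor `1 + ε` of `y`. -/
def WithinFactor (ε x y : ℝ) : Prop :=
  y / (1 + ε) ≤ x ∧ x ≤ (1 + ε) * y

/-! ### Weighted graphs and maximum cuts -/

/-- A finite graph with vertices in `V`, with a weight on every edge. The values of `weight`
outside `edges` are never used. -/
structure WGraph (V : Type*) where
  verts : Finset V
  edges : Finset (Sym2 V)
  weight : Sym2 V → ℝ

namespace WGraph

variable {V : Type*}

open scoped Classical in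
/-- An unweighted simple graph: all edges have weight `1`. -/
noncomputable def ofSimpleGraph [Fintype V] (G : SimpleGraph V) : WGraph V where
  verts := Finset.univ
  edges := Finset.univ.filter fun e => e ∈ G.edgeSet
  weight := fun _ => 1

def totalWeight (H : WGraph V) : ℝ := ∑ e ∈ H.edges, H.weight e

open scoped Classical in
/-- The (weighted) degree. -/
noncomputable def degree (H : WGraph V) (i : V) : ℝ :=
  ∑ e ∈ H.edges.filter (fun e => i ∈ e), H.weight e

noncomputable def avgDegree (H : WGraph V) : ℝ := (∑ i ∈ H.verts, H.degree i) / H.verts.card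

/-- The total size: the number of vertices plus the number of edges. -/
def size (H : WGraph V) : ℕ := H.verts.card + H.edges.card

open scoped Classical in
/-- The total weight of the edges between `A` and the other vertices. -/
noncomputable def cutWeight (H : WGraph V) (A : Finset V) : ℝ :=
  ∑ e ∈ H.edges.filter (fun e => ∃ a ∈ A, ∃ b ∈ H.verts \ A, e = s(a, b)), H.weight e

/-- The maximum of the cut weight over all partitions `(A, verts \ A)` of the vertices. -/
noncomputable def maxCut (H : WGraph V) : ℝ :=
  H.verts.powerset.sup' ⟨∅, Finset.empty_mem_powerset _⟩ H.cutWeight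

/-- Outcome of vertex sampling when the sampled set is `S`. -/
noncomputable def vertexSample (G : WGraph V) (p : V → ℝ) (S : Finset V) : WGraph V where
  verts := S
  edges := edgesWithin G.edges S
  weight := fun e => vertexScale p G.avgDegree e * G.weight e

/-- The probability with which edge sampling keeps the edge `e`. -/
noncomputable def edgeProb (H : WGraph V) (ε : ℝ) (e : Sym2 V) : ℝ :=
  min 1 (8 * H.verts.card * H.weight e / (ε ^ 2 * H.totalWeight))

/-- Outcome of edge sampling when the set of kept edges is `F`. -/
noncomputable def edgeSample (H : WGraph V) (ε : ℝ) (F : Finset (Sym2 V)) : WGraph V where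
  verts := H.verts
  edges := F
  weight := fun e => H.weight e / H.edgeProb ε e

/-- The probability that the graph obtained from `G` by vertex sampling with probabilities `p`,
followed by edge sampling, has the property `P`. -/
noncomputable def sampleProb [Fintype V] (G : WGraph V) (p : V → ℝ) (ε : ℝ)
    (P : WGraph V → Prop) : ℝ :=
  twoStageProb G.edges p (fun S => (G.vertexSample p S).edgeProb ε)
    fun S F => P ((G.vertexSample p S).edgeSample ε F)

/-- `H` is an `ε`-core-set of `G` for the maximum cut problem; the value of `H` is multiplied by
`Δ ^ 2`, to undo the normalisation of the weights in vertex sampling. -/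
def IsCoreSet (ε : ℝ) (G H : WGraph V) : Prop :=
  WithinFactor ε (G.avgDegree ^ 2 * H.maxCut) G.maxCut

end WGraph

/-! ### Correlation clustering -/

/-- A finite graph with vertices in `V` and weights `c⁺`, `c⁻` on every edge. The values of
`cPos`, `cNeg` outside `edges` are never used. -/
structure CCGraph (V : Type*) where
  verts : Finset V
  edges : Finset (Sym2 V)
  cPos : Sym2 V → ℝ
  cNeg : Sym2 V → ℝ

namespace CCGraph

variable {V : Type*}

open scoped Classical in
/-- The correlation clustering instance on all of `V` with edges those of `G`. -/
noncomputable def ofSimpleGraph [Fintype V] (G : SimpleGraph V) (cPos cNeg : Sym2 V → ℝ) :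
    CCGraph V where
  verts := Finset.univ
  edges := Finset.univ.filter fun e => e ∈ G.edgeSet
  cPos := cPos
  cNeg := cNeg

/-- The weighted graph with the weights `|η|`, where `η = c⁺ - c⁻`. -/
def absGraph (H : CCGraph V) : WGraph V where
  verts := H.verts
  edges := H.edges
  weight := fun e => |H.cPos e - H.cNeg e|

/-- The total size: the number of vertices plus the number of edges. -/
def size (H : CCGraph V) : ℕ := H.verts.card + H.edges.card

open scoped Classical in
/-- The indicator that the end points of `e` are in the same cluster. -/
noncomputable def sameCluster {S : Finset V} (P : Finpartition S) (e : Sym2 V) : ℝ :=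
  if ∃ c ∈ P.parts, ∀ v ∈ e, v ∈ c then 1 else 0

open scoped Classical in
/-- The MAX-AGREE score of a clustering. -/
noncomputable def score (H : CCGraph V) (P : Finpartition H.verts) : ℝ :=
  ∑ e ∈ H.edges, H.cPos e * sameCluster P e + ∑ e ∈ H.edges, H.cNeg e * (1 - sameCluster P e)

open scoped Classical in
/-- The maximum of the MAX-AGREE score over all clusterings. -/
noncomputable def maxAgree (H : CCGraph V) : ℝ :=
  (Finset.univ : Finset (Finpartition H.verts)).sup' Finset.univ_nonempty H.score

/-- Outcome of vertex sampling when the sampled set is `S`. -/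
noncomputable def vertexSample (G : CCGraph V) (p : V → ℝ) (S : Finset V) : CCGraph V where
  verts := S
  edges := edgesWithin G.edges S
  cPos := fun e => vertexScale p G.absGraph.avgDegree e * G.cPos e
  cNeg := fun e => vertexScale p G.absGraph.avgDegree e * G.cNeg e

/-- Outcome of edge sampling when the set of kept edges is `F`. -/
noncomputable def edgeSample (H : CCGraph V) (ε : ℝ) (F : Finset (Sym2 V)) : CCGraph V where
  verts := H.verts
  edges := F
  cPos := fun e => H.cPos e / H.absGraph.edgeProb ε e
  cNeg := fun e => H.cNeg e / H.absGraph.edgeProb ε e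

/-- The probability that the instance obtained from `G` by vertex sampling with probabilities
`p`, followed by edge sampling, has the property `P`. -/
noncomputable def sampleProb [Fintype V] (G : CCGraph V) (p : V → ℝ) (ε : ℝ)
    (P : CCGraph V → Prop) : ℝ :=
  twoStageProb G.edges p (fun S => (G.vertexSample p S).absGraph.edgeProb ε)
    fun S F => P ((G.vertexSample p S).edgeSample ε F)

/-- `H` is an `ε`-core-set of `G` for correlation clustering; the value of `H` is multiplied by
`Δ ^ 2`, to undo the normalisation of the weights in vertex sampling. -/
def IsCoreSet (ε : ℝ) (G H : CCGraph V) : Prop :=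
  WithinFactor ε (G.absGraph.avgDegree ^ 2 * H.maxAgree) G.maxAgree

end CCGraph

/-!
Both problems ask for a labelling of the vertices that maximises the total positive weight of the
edges with equal labels plus the total negative weight of the others. Maximum cut is the case of
two labels and no positive weights (`WGraph.maxCut_eq`); in correlation clustering there are as
many labels as vertices (`CCGraph.maxAgree_eq`), but merging them at random into `⌈1000 / ε⌉`
labels costs only a factor `1 - ε / 1000` (`labelScore_le_max_fin`). So the number `q` of labels
may be taken to be `O(1 / ε)`, and the maximum is at least a quarter of `n * Δ`, as a random
labelling with two labels shows. This makes additive errors of order `ε * n * Δ` harmless.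

*Vertex sampling.* Let `y i` be `1 / p i` for the sampled vertices and `0` for the others. Up to
the total negative weight, the score of a labelling `x` of the sample is the value at `y * x` of the
quadratic form of the matrix `η = c⁺ - c⁻`. Were the vector `r = labelAct η (y * x)` known, the
form would be linear in `y`. By Maurey's empirical method, `r` is close to an average of `k`
vectors that are given by labelled vertices, with `k` of order `q * n / (Δ * ε ^ 2)`
(`exists_seedEstimate_near`): so a net of `(n * q + 1) ^ k` estimates `ρ`, none of which depends
on the sample, serves all labellings of all samples. For a fixed `ρ`, linear programming duality on
the whole graph (`exists_dual_certificate`, from Sion's minimax theorem) provides a vector `z` that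
bounds the score of every labelling of the sample compatible with `ρ` by the maximum for the whole
graph plus a linear function of `y - 1` (`labelForm_scaled_le`). Only this linear function
has to be controlled; its coefficients are `O(g i)` for the truncated degrees `g i = max (d i)
(ε * Δ)`, the probabilities `p i` are proportional to `g i`, and Bernstein's inequality
(`IsSampling.linear_tail`) is strong enough for a union bound over the net
(`IsSampling.prob_maxLabelForm`). The lower bound needs only one labelling, an optimal one.

*Edge sampling.* The deviation of the score of a labelling is an average of deviations of signed
sums over sign vectors on the vertices (`sum_mul_sameLabel_le_of_signs`). With `s` sampled vertices
there are `2 ^ s` sign vectors, whatever the number of labels, and Bernstein's inequality with the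
constant `8` of the sampling probabilities has an exponent larger than `s * log 2` already for an
error below `ε` (`bernoulliProb_edge_sampling`).

The probabilities of failure add up to less than `1 / n ^ 2` (`twoStageProb_maxLabelScore`).
-/

/-! ### Expectations and tail bounds for random subsets -/

section RandomSubset

variable {ι : Type*}

/-- The expectation of `f A` for a random subset `A` of `U` that contains every `i ∈ U`
independently with probability `p i`. -/
noncomputable def bernoulliExp (U : Finset ι) (p : ι → ℝ) (f : Finset ι → ℝ) : ℝ :=
  ∑ A ∈ U.powerset, bernoulliMass U p A * f A

open scoped Classical in
/-- The probability that the random subset `A` of `U` satisfies `ev`. -/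
noncomputable def bernoulliProb (U : Finset ι) (p : ι → ℝ) (ev : Finset ι → Prop) : ℝ :=
  bernoulliExp U p fun A => if ev A then 1 else 0

theorem bernoulliMass_nonneg {U : Finset ι} {p : ι → ℝ} (hp : ∀ i ∈ U, 0 ≤ p i ∧ p i ≤ 1)
    {A : Finset ι} (hA : A ⊆ U) : 0 ≤ bernoulliMass U p A := by
  classical
  unfold bernoulliMass
  refine mul_nonneg (Finset.prod_nonneg fun i hi => (hp i (hA hi)).1)
    (Finset.prod_nonneg fun i hi => ?_)
  have hi' : i ∈ U := by
    simp only [Finset.mem_sdiff] at hi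
    exact hi.1
  linarith [(hp i hi').2]

theorem bernoulliExp_mono {U : Finset ι} {p : ι → ℝ} (hp : ∀ i ∈ U, 0 ≤ p i ∧ p i ≤ 1)
    {f g : Finset ι → ℝ} (h : ∀ A ⊆ U, f A ≤ g A) : bernoulliExp U p f ≤ bernoulliExp U p g :=
  Finset.sum_le_sum fun A hA => mul_le_mul_of_nonneg_left (h A (Finset.mem_powerset.1 hA))
    (bernoulliMass_nonneg hp (Finset.mem_powerset.1 hA))

theorem bernoulliExp_const (U : Finset ι) (p : ι → ℝ) (c : ℝ) :
    bernoulliExp U p (fun _ => c) = c := by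
  unfold bernoulliExp
  rw [← Finset.sum_mul, sum_bernoulliMass, one_mul]

theorem bernoulliExp_sum {κ : Type*} (U : Finset ι) (p : ι → ℝ) (T : Finset κ)
    (f : κ → Finset ι → ℝ) :
    bernoulliExp U p (fun A => ∑ k ∈ T, f k A) = ∑ k ∈ T, bernoulliExp U p (f k) := by
  unfold bernoulliExp
  rw [Finset.sum_comm]
  exact Finset.sum_congr rfl fun A _ => Finset.mul_sum _ _ _

theorem bernoulliExp_mul_left (U : Finset ι) (p : ι → ℝ) (c : ℝ) (f : Finset ι → ℝ) :
    bernoulliExp U p (fun A => c * f A) = c * bernoulliExp U p f := by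
  unfold bernoulliExp
  rw [Finset.mul_sum]
  exact Finset.sum_congr rfl fun A _ => by ring

theorem bernoulliProb_le_exp {U : Finset ι} {p : ι → ℝ} (hp : ∀ i ∈ U, 0 ≤ p i ∧ p i ≤ 1)
    {ev : Finset ι → Prop} {f : Finset ι → ℝ} (hf : ∀ A ⊆ U, 0 ≤ f A)
    (h : ∀ A ⊆ U, ev A → 1 ≤ f A) : bernoulliProb U p ev ≤ bernoulliExp U p f := by
  refine bernoulliExp_mono hp fun A hA => ?_
  split_ifs with hev
  · exact h A hA hev
  · exact hf A hA

theorem bernoulliProb_mono {U : Finset ι} {p : ι → ℝ} (hp : ∀ i ∈ U, 0 ≤ p i ∧ p i ≤ 1)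
    {ev ev' : Finset ι → Prop} (h : ∀ A ⊆ U, ev A → ev' A) :
    bernoulliProb U p ev ≤ bernoulliProb U p ev' := by
  refine bernoulliProb_le_exp hp (fun A _ => ?_) (fun A hA hev => ?_)
  · split_ifs <;> norm_num
  · rw [if_pos (h A hA hev)]

theorem bernoulliProb_nonneg {U : Finset ι} {p : ι → ℝ} (hp : ∀ i ∈ U, 0 ≤ p i ∧ p i ≤ 1)
    (ev : Finset ι → Prop) : 0 ≤ bernoulliProb U p ev := by
  have := bernoulliExp_mono hp (f := fun _ => 0) (g := fun A => open Classical in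
    if ev A then (1 : ℝ) else 0) (fun A _ => by split_ifs <;> norm_num)
  rwa [bernoulliExp_const] at this

theorem bernoulliProb_not (U : Finset ι) (p : ι → ℝ) (ev : Finset ι → Prop) :
    bernoulliProb U p (fun A => ¬ ev A) = 1 - bernoulliProb U p ev := by
  rw [eq_sub_iff_add_eq, ← sum_bernoulliMass U p]
  unfold bernoulliProb bernoulliExp
  rw [← Finset.sum_add_distrib]
  refine Finset.sum_congr rfl fun A _ => ?_
  by_cases h : ev A <;> simp [h]

theorem bernoulliProb_exists_le {κ : Type*} {U : Finset ι} {p : ι → ℝ}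
    (hp : ∀ i ∈ U, 0 ≤ p i ∧ p i ≤ 1) (T : Finset κ) (ev : κ → Finset ι → Prop) :
    bernoulliProb U p (fun A => ∃ k ∈ T, ev k A) ≤ ∑ k ∈ T, bernoulliProb U p (ev k) := by
  classical
  unfold bernoulliProb
  rw [← bernoulliExp_sum]
  refine bernoulliProb_le_exp hp (fun A _ => Finset.sum_nonneg fun k _ => ?_) fun A _ h => ?_
  · split_ifs <;> norm_num
  · obtain ⟨k, hk, hev⟩ := h
    refine le_trans ?_ (Finset.single_le_sum (fun k _ => ?_) hk)
    · rw [if_pos hev]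
    · split_ifs <;> norm_num

theorem bernoulliProb_or_le {U : Finset ι} {p : ι → ℝ} (hp : ∀ i ∈ U, 0 ≤ p i ∧ p i ≤ 1)
    (ev ev' : Finset ι → Prop) :
    bernoulliProb U p (fun A => ev A ∨ ev' A) ≤ bernoulliProb U p ev + bernoulliProb U p ev' := by
  have h := bernoulliProb_exists_le hp (Finset.univ : Finset Bool)
    (fun b A => if b then ev A else ev' A)
  simpa [or_comm] using h

open scoped Classical in
theorem bernoulliExp_prod (U : Finset ι) (p φ ψ : ι → ℝ) :
    bernoulliExp U p (fun A => ∏ i ∈ U, if i ∈ A then φ i else ψ i) =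
      ∏ i ∈ U, (p i * φ i + (1 - p i) * ψ i) := by
  rw [Finset.prod_add]
  refine Finset.sum_congr rfl fun A hA => ?_
  have hA := Finset.mem_powerset.1 hA
  beta_reduce
  rw [Finset.prod_ite, Finset.prod_mul_distrib, Finset.prod_mul_distrib]
  have h1 : U.filter (fun i => i ∈ A) = A := by
    ext i; simp only [Finset.mem_filter]; exact ⟨fun h => h.2, fun h => ⟨hA h, h⟩⟩
  have h2 : U.filter (fun i => i ∉ A) = U \ A := by
    ext i; simp
  rw [h1, h2]
  unfold bernoulliMass
  convert mul_mul_mul_comm (∏ i ∈ A, p i) (∏ i ∈ U \ A, (1 - p i)) (∏ i ∈ A, φ i)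
    (∏ i ∈ U \ A, ψ i) using 2

open scoped Classical in
/-- Chernoff's method: Markov's inequality for the exponential of a sum of independent terms. -/
theorem bernoulliProb_le_prod {U : Finset ι} {p : ι → ℝ} (hp : ∀ i ∈ U, 0 ≤ p i ∧ p i ≤ 1)
    (a b : ι → ℝ) (t : ℝ) :
    bernoulliProb U p (fun A => t ≤ ∑ i ∈ U, if i ∈ A then a i else b i) ≤
      Real.exp (-t) * ∏ i ∈ U, (p i * Real.exp (a i) + (1 - p i) * Real.exp (b i)) := by
  rw [← bernoulliExp_prod, ← bernoulliExp_mul_left]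
  have key : ∀ A : Finset ι, Real.exp (-t) *
      ∏ i ∈ U, (if i ∈ A then Real.exp (a i) else Real.exp (b i)) =
      Real.exp ((∑ i ∈ U, if i ∈ A then a i else b i) - t) := fun A => by
    rw [sub_eq_neg_add, Real.exp_add, Real.exp_sum]
    congr 1
    exact Finset.prod_congr rfl fun i _ => by split_ifs <;> rfl
  refine bernoulliProb_le_exp hp (fun A _ => ?_) (fun A _ h => ?_)
  · rw [key]; positivity
  · rw [key]; exact Real.one_le_exp (by linarith)

/-- The moment generating function of one centred, rescaled Bernoulli variable. -/
theorem centred_mgf_le {K r : ℝ} (hK : 0 ≤ K)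
    (hexp : ∀ u : ℝ, |u| ≤ r → Real.exp u ≤ 1 + u + K * u ^ 2) {p c v : ℝ} (hp0 : 0 ≤ p)
    (hp1 : p ≤ 1) (hv : 0 ≤ v) (h : p = 1 ∨ (|c| ≤ r * p ∧ c ^ 2 ≤ p * v)) :
    p * Real.exp (c * (1 / p - 1)) + (1 - p) * Real.exp (-c) ≤ Real.exp (K * v) := by
  rcases h with rfl | ⟨h1, h2⟩
  · simpa using mul_nonneg hK hv
  rcases hp0.eq_or_lt with rfl | hp
  · have hc : c = 0 := by simpa using h1
    simpa [hc] using mul_nonneg hK hv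
  have hr : 0 ≤ r := by
    by_contra hr
    nlinarith [abs_nonneg c]
  have e1 := hexp (c * (1 / p - 1)) (by
    have h0 : 0 ≤ 1 / p - 1 := by rw [sub_nonneg]; exact (one_le_div hp).2 hp1
    rw [abs_mul, abs_of_nonneg h0]
    calc |c| * (1 / p - 1) ≤ (r * p) * (1 / p - 1) := by gcongr
      _ = r * (1 - p) := by field_simp
      _ ≤ r := by nlinarith)
  have e2 := hexp (-c) (by rw [abs_neg]; nlinarith)
  have key : p * (1 + c * (1 / p - 1) + K * (c * (1 / p - 1)) ^ 2)
      + (1 - p) * (1 + -c + K * (-c) ^ 2) = 1 + K * ((1 - p) * (c ^ 2 / p)) := by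
    field_simp
    ring
  have h3 : c ^ 2 / p ≤ v := by rw [div_le_iff₀ hp]; linarith
  have h4 : (1 - p) * (c ^ 2 / p) ≤ v := by
    have : 0 ≤ c ^ 2 / p := by positivity
    nlinarith
  calc _ ≤ p * (1 + c * (1 / p - 1) + K * (c * (1 / p - 1)) ^ 2)
      + (1 - p) * (1 + -c + K * (-c) ^ 2) := by
        have : 0 ≤ 1 - p := by linarith
        gcongr
    _ = 1 + K * ((1 - p) * (c ^ 2 / p)) := key
    _ ≤ K * v + 1 := by nlinarith
    _ ≤ _ := Real.add_one_le_exp _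

open scoped Classical in
/-- The factor by which the contribution of `i` is rescaled when the random set is `A`, so
that its expectation is `1`. -/
noncomputable def inverseWeight (p : ι → ℝ) (A : Finset ι) (i : ι) : ℝ :=
  if i ∈ A then 1 / p i else 0

/-- A Bernstein inequality for the rescaled sums `∑ c i * inverseWeight p A i`. -/
theorem bernoulliProb_centred_le {U : Finset ι} {p : ι → ℝ} (hp : ∀ i ∈ U, 0 ≤ p i ∧ p i ≤ 1)
    {K r : ℝ} (hK : 0 ≤ K) (hexp : ∀ u : ℝ, |u| ≤ r → Real.exp u ≤ 1 + u + K * u ^ 2)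
    {c v : ι → ℝ} (hv : ∀ i ∈ U, 0 ≤ v i)
    (h : ∀ i ∈ U, p i = 1 ∨ (|c i| ≤ r * p i ∧ c i ^ 2 ≤ p i * v i)) (t : ℝ) :
    bernoulliProb U p (fun A => t ≤ ∑ i ∈ U, c i * (inverseWeight p A i - 1)) ≤
      Real.exp (-t + K * ∑ i ∈ U, v i) := by
  classical
  have h1 := bernoulliProb_le_prod hp (fun i => c i * (1 / p i - 1)) (fun i => - c i) t
  have h2 : ∀ A : Finset ι, ∑ i ∈ U, c i * (inverseWeight p A i - 1) =
      ∑ i ∈ U, if i ∈ A then c i * (1 / p i - 1) else - c i := fun A => by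
    refine Finset.sum_congr rfl fun i _ => ?_
    unfold inverseWeight
    split_ifs <;> ring
  simp only [h2]
  refine le_trans (le_of_eq ?_) (h1.trans ?_)
  · congr!
  rw [Real.exp_add, Finset.mul_sum, Real.exp_sum]
  refine mul_le_mul_of_nonneg_left (Finset.prod_le_prod (fun i hi => ?_) fun i hi => ?_)
    (Real.exp_pos _).le
  · have := hp i hi
    have : 0 ≤ 1 - p i := by linarith
    have := (hp i hi).1
    positivity
  · exact centred_mgf_le hK hexp (hp i hi).1 (hp i hi).2 (hv i hi) (h i hi)

theorem exp_le_one_add_add_sq {u : ℝ} (hu : |u| ≤ 1) : Real.exp u ≤ 1 + u + 1 * u ^ 2 := by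
  have := Real.abs_exp_sub_one_sub_id_le hu
  rw [abs_le] at this
  linarith [this.2]

theorem exp_le_one_add_add_mul_sq {u : ℝ} (hu : |u| ≤ 2 / 5) :
    Real.exp u ≤ 1 + u + 29 / 50 * u ^ 2 := by
  have h := Real.exp_bound (x := u) (by linarith) (n := 4) (by norm_num)
  simp [Finset.sum_range_succ, Nat.factorial] at h
  rw [abs_le] at h hu
  have h2 := h.2
  have h4 : |u| ^ 4 = u ^ 4 := by rw [← abs_pow, abs_of_nonneg (by positivity)]
  rw [h4] at h2
  have h3 : u ^ 2 * u ≤ u ^ 2 * (2 / 5) := mul_le_mul_of_nonneg_left hu.2 (sq_nonneg u)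
  have h5 : u ^ 2 * u ^ 2 ≤ u ^ 2 * (4 / 25) :=
    mul_le_mul_of_nonneg_left (by nlinarith) (sq_nonneg u)
  nlinarith

end RandomSubset

/-! ### Labellings and their scores -/

section Labelling

variable {V Λ : Type*}

open scoped Classical in
/-- The indicator that the end points of `e` have the same label. -/
noncomputable def sameLabel (x : V → Λ) (e : Sym2 V) : ℝ :=
  if ∀ v ∈ e, ∀ w ∈ e, x v = x w then 1 else 0

open scoped Classical in
theorem sameLabel_mk (x : V → Λ) (i j : V) :
    sameLabel x s(i, j) = if x i = x j then 1 else 0 := by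
  unfold sameLabel
  congr 1
  simp only [Sym2.mem_iff, forall_eq_or_imp, forall_eq, eq_iff_iff]
  constructor
  · rintro ⟨⟨_, h⟩, _⟩; exact h
  · intro h; simp [h]

theorem sameLabel_nonneg (x : V → Λ) (e : Sym2 V) : 0 ≤ sameLabel x e := by
  unfold sameLabel; split_ifs <;> norm_num

theorem sameLabel_le_one (x : V → Λ) (e : Sym2 V) : sameLabel x e ≤ 1 := by
  unfold sameLabel; split_ifs <;> norm_num

theorem sameLabel_congr {Λ' : Type*} {x : V → Λ} {y : V → Λ'} {e : Sym2 V}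
    (h : ∀ v ∈ e, ∀ w ∈ e, (x v = x w ↔ y v = y w)) : sameLabel x e = sameLabel y e := by
  unfold sameLabel
  congr 1
  refine propext ⟨fun H v hv w hw => (h v hv w hw).1 (H v hv w hw),
    fun H v hv w hw => (h v hv w hw).2 (H v hv w hw)⟩

/-- The score of a labelling: the sum of `cp` over the edges whose end points have the same label
plus the sum of `cm` over the other edges. -/
noncomputable def labelScore (E : Finset (Sym2 V)) (cp cm : Sym2 V → ℝ) (x : V → Λ) : ℝ :=
  ∑ e ∈ E, (cp e * sameLabel x e + cm e * (1 - sameLabel x e))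

variable (Λ) in
/-- The maximum score of a labelling with labels in `Λ`. Maximum cut is the case of two labels
and `cp = 0`, correlation clustering that of as many labels as there are vertices. -/
noncomputable def maxLabelScore (E : Finset (Sym2 V)) (cp cm : Sym2 V → ℝ) : ℝ :=
  ⨆ x : V → Λ, labelScore E cp cm x

theorem labelScore_le_max [Finite V] [Finite Λ] (E : Finset (Sym2 V)) (cp cm : Sym2 V → ℝ)
    (x : V → Λ) : labelScore E cp cm x ≤ maxLabelScore Λ E cp cm :=
  le_ciSup (Set.finite_range (fun x : V → Λ => labelScore E cp cm x)).bddAbove x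

theorem exists_labelScore_eq_max [Finite V] [Finite Λ] [Nonempty Λ] (E : Finset (Sym2 V))
    (cp cm : Sym2 V → ℝ) : ∃ x : V → Λ, labelScore E cp cm x = maxLabelScore Λ E cp cm :=
  exists_eq_ciSup_of_finite

/-- Two distinct points get the same label from a uniformly random map with probability `1/q`. -/
theorem sum_ite_apply_eq [Fintype Λ] [DecidableEq Λ] (q : ℕ) [NeZero q] {a b : Λ} (hab : a ≠ b) :
    (q : ℝ) * ∑ f : Λ → Fin q, (if f a = f b then (1 : ℝ) else 0) =
      Fintype.card (Λ → Fin q) := by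
  -- adding `c` to the value at `a` permutes the maps
  have hshift : ∀ c : Fin q, ∑ f : Λ → Fin q, (if f a = f b then (1 : ℝ) else 0) =
      ∑ f : Λ → Fin q, (if f a + c = f b then (1 : ℝ) else 0) := fun c => by
    have hinj : Function.Injective
        (fun f : Λ → Fin q => Function.update f a (f a + c)) := fun f g h => by
      funext i
      have hi := congrFun h i
      by_cases hia : i = a
      · subst hia; simpa using hi
      · simpa [Function.update_of_ne hia] using hi
    symm
    refine Fintype.sum_bijective _ (Finite.injective_iff_bijective.1 hinj) _ _ fun f => ?_
    rw [Function.update_self, Function.update_of_ne hab.symm]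
  have h1 : (q : ℝ) * ∑ f : Λ → Fin q, (if f a = f b then (1 : ℝ) else 0) =
      ∑ c : Fin q, ∑ f : Λ → Fin q, (if f a + c = f b then (1 : ℝ) else 0) := by
    rw [← Finset.sum_congr rfl fun c _ => hshift c]
    simp
  rw [h1, Finset.sum_comm]
  have h2 : ∀ f : Λ → Fin q, ∑ c : Fin q, (if f a + c = f b then (1 : ℝ) else 0) = 1 := fun f => by
    rw [Finset.sum_eq_single (f b - f a)]
    · simp
    · intro c _ hc
      rw [if_neg]
      intro h
      exact hc (by rw [← h]; simp)
    · simp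
  simp [h2]

theorem sum_sameLabel_comp [Fintype Λ] [DecidableEq Λ] (q : ℕ) [NeZero q] (x : V → Λ)
    (e : Sym2 V) : ∑ f : Λ → Fin q, sameLabel (f ∘ x) e =
      Fintype.card (Λ → Fin q) * (sameLabel x e + (1 - sameLabel x e) / q) := by
  induction e using Sym2.ind with
  | h i j =>
    have hq : (q : ℝ) ≠ 0 := Nat.cast_ne_zero.2 (NeZero.ne q)
    by_cases h : x i = x j
    · simp [sameLabel_mk, h]
    · have := sum_ite_apply_eq q h
      simp only [sameLabel_mk, Function.comp_apply, if_neg h]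
      rw [zero_add, sub_zero, ← this, mul_comm (q : ℝ), mul_assoc, mul_one_div_cancel hq, mul_one]
      congr!

theorem sum_labelScore_comp [Fintype Λ] [DecidableEq Λ] (q : ℕ) [NeZero q] (E : Finset (Sym2 V))
    (cp cm : Sym2 V → ℝ) (x : V → Λ) : ∑ f : Λ → Fin q, labelScore E cp cm (f ∘ x) =
      Fintype.card (Λ → Fin q) * ∑ e ∈ E, (cp e * (sameLabel x e + (1 - sameLabel x e) / q) +
        cm e * (1 - (sameLabel x e + (1 - sameLabel x e) / q))) := by
  unfold labelScore
  rw [Finset.sum_comm, Finset.mul_sum]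
  refine Finset.sum_congr rfl fun e _ => ?_
  have h := sum_sameLabel_comp q x e
  rw [Finset.sum_add_distrib, ← Finset.mul_sum, ← Finset.mul_sum, Finset.sum_sub_distrib, h]
  simp only [Finset.sum_const, Finset.card_univ, nsmul_eq_mul, mul_one]
  ring

theorem sum_labelScore_comp_le [Finite V] [Fintype Λ] [DecidableEq Λ] (q : ℕ)
    (E : Finset (Sym2 V)) (cp cm : Sym2 V → ℝ) (x : V → Λ) :
    ∑ f : Λ → Fin q, labelScore E cp cm (f ∘ x) ≤
      Fintype.card (Λ → Fin q) * maxLabelScore (Fin q) E cp cm := by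
  rw [← nsmul_eq_mul]
  exact Finset.sum_le_card_nsmul _ _ _ fun f _ => labelScore_le_max E cp cm (f ∘ x)

/-- Restricting to `q` labels costs a factor `1 - 1 / q` at most: merge the labels at random. -/
theorem labelScore_le_max_fin [Finite V] [Fintype Λ] (q : ℕ) [NeZero q] {E : Finset (Sym2 V)}
    {cp cm : Sym2 V → ℝ} (hp : ∀ e ∈ E, 0 ≤ cp e) (x : V → Λ) :
    (1 - 1 / (q : ℝ)) * labelScore E cp cm x ≤ maxLabelScore (Fin q) E cp cm := by
  classical
  have h1 := sum_labelScore_comp_le q E cp cm x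
  rw [sum_labelScore_comp] at h1
  have hc : (0 : ℝ) < Fintype.card (Λ → Fin q) := by
    exact_mod_cast Fintype.card_pos
  refine le_trans ?_ (le_of_mul_le_mul_left h1 hc)
  unfold labelScore
  rw [Finset.mul_sum]
  refine Finset.sum_le_sum fun e he => ?_
  have hq : (0 : ℝ) < 1 / q := by
    have : (0 : ℝ) < q := Nat.cast_pos.2 (NeZero.pos q)
    positivity
  have h2 := mul_nonneg (mul_nonneg (hp e he) hq.le) (sameLabel_nonneg x e)
  have h3 : 0 ≤ cp e * (1 / (q : ℝ)) * (1 - sameLabel x e) :=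
    mul_nonneg (mul_nonneg (hp e he) hq.le) (by linarith [sameLabel_le_one x e])
  rw [div_eq_mul_one_div (1 - sameLabel x e)]
  nlinarith

/-- A uniformly random labelling with two labels gains half of the total weight. -/
theorem half_sum_le_max_fin_two [Finite V] {E : Finset (Sym2 V)} (hE : ∀ e ∈ E, ¬ e.IsDiag)
    (cp cm : Sym2 V → ℝ) :
    (∑ e ∈ E, (cp e + cm e)) / 2 ≤ maxLabelScore (Fin 2) E cp cm := by
  classical
  have := Fintype.ofFinite V
  have h1 := sum_labelScore_comp_le 2 E cp cm (id : V → V)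
  rw [sum_labelScore_comp] at h1
  have hc : (0 : ℝ) < Fintype.card (V → Fin 2) := by
    exact_mod_cast Fintype.card_pos
  refine le_trans (le_of_eq ?_) (le_of_mul_le_mul_left h1 hc)
  rw [Finset.sum_div]
  refine Finset.sum_congr rfl fun e he => ?_
  have : sameLabel (id : V → V) e = 0 := by
    have := hE e he
    induction e using Sym2.ind with
    | h i j => rw [sameLabel_mk, if_neg (by simpa using this)]
  rw [this]
  push_cast
  ring

/-- As many labels as there are vertices are enough for all labellings. -/
theorem labelScore_le_max_self [Finite V] [Nonempty V] (E : Finset (Sym2 V))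
    (cp cm : Sym2 V → ℝ) (x : V → Λ) : labelScore E cp cm x ≤ maxLabelScore V E cp cm := by
  refine le_trans (le_of_eq ?_) (labelScore_le_max E cp cm fun v => Function.invFun x (x v))
  unfold labelScore
  refine Finset.sum_congr rfl fun e _ => ?_
  have : sameLabel x e = sameLabel (fun v => Function.invFun x (x v)) e :=
    sameLabel_congr fun v _ w _ => ⟨fun h => by simp only [h], fun h => by
      have hx : ∀ v, x (Function.invFun x (x v)) = x v := fun v => Function.invFun_eq ⟨v, rfl⟩
      rw [← hx v, ← hx w, h]⟩
  rw [this]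

/-- The indicator that two labels agree is the average, over random signs attached to the labels,
of the product of the two signs. So a bound for all sign vectors gives one for all labellings. -/
theorem sum_mul_sameLabel_le_of_signs [Fintype V] (F : Finset (Sym2 V)) (D : Sym2 V → ℝ) {B : ℝ}
    (h : ∀ σ : V → Fin 2, ∑ e ∈ F, D e * (2 * sameLabel σ e - 1) ≤ B) [Fintype Λ] (x : V → Λ) :
    ∑ e ∈ F, D e * sameLabel x e ≤ B := by
  classical
  have hc : (0 : ℝ) < Fintype.card (Λ → Fin 2) := by
    exact_mod_cast Fintype.card_pos
  have h1 : ∑ f : Λ → Fin 2, ∑ e ∈ F, D e * (2 * sameLabel (f ∘ x) e - 1) ≤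
      Fintype.card (Λ → Fin 2) * B := by
    rw [← nsmul_eq_mul]
    exact Finset.sum_le_card_nsmul _ _ _ fun f _ => h (f ∘ x)
  refine le_of_mul_le_mul_left (le_trans (le_of_eq ?_) h1) hc
  rw [Finset.sum_comm, Finset.mul_sum]
  refine Finset.sum_congr rfl fun e _ => ?_
  have h2 := sum_sameLabel_comp 2 x e
  rw [← Finset.mul_sum, Finset.sum_sub_distrib, ← Finset.mul_sum, h2]
  simp only [Finset.sum_const, Finset.card_univ, nsmul_eq_mul, mul_one]
  push_cast
  ring

open scoped Classical in
/-- A sum over the edges, as a sum over ordered pairs of vertices. -/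
theorem sum_sum_ite_mem_edges [Fintype V] {E : Finset (Sym2 V)} (hE : ∀ e ∈ E, ¬ e.IsDiag)
    (φ : Sym2 V → ℝ) :
    ∑ i, ∑ j, (if s(i, j) ∈ E then φ s(i, j) else 0) = 2 * ∑ e ∈ E, φ e := by
  rw [← Fintype.sum_prod_type' (f := fun i j => if s(i, j) ∈ E then φ s(i, j) else 0)]
  rw [← Finset.sum_filter]
  rw [← Finset.sum_fiberwise_of_maps_to (s := Finset.univ.filter fun z : V × V => s(z.1, z.2) ∈ E)
    (t := E) (g := fun z => s(z.1, z.2)) (fun z hz => (Finset.mem_filter.1 hz).2), Finset.mul_sum]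
  refine Finset.sum_congr rfl fun e he => ?_
  have hd := hE e he
  induction e using Sym2.ind with
  | h a b =>
    have hab : a ≠ b := by simpa using hd
    have : (Finset.univ.filter fun z : V × V => s(z.1, z.2) ∈ E).filter
        (fun z => s(z.1, z.2) = s(a, b)) = {(a, b), (b, a)} := by
      ext ⟨c, d⟩
      simp only [Finset.mem_filter, Finset.mem_univ, true_and, Finset.mem_insert,
        Finset.mem_singleton, Prod.mk.injEq]
      constructor
      · rintro ⟨_, h⟩
        simpa using h
      · intro h
        have h' : s(c, d) = s(a, b) := by simpa using h
        exact ⟨h' ▸ he, h'⟩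
    rw [this, Finset.sum_pair (by simp [hab]), Sym2.eq_swap]
    ring

end Labelling

/-! ### Edge sampling -/

section EdgeSampling

variable {V Λ : Type*}

/-- The score of a labelling after edge sampling, in terms of the rescaled indicators of the kept
edges. -/
theorem labelScore_sampled {U F : Finset (Sym2 V)} (hF : F ⊆ U) (cp cm pe : Sym2 V → ℝ)
    (x : V → Λ) :
    labelScore F (fun e => cp e / pe e) (fun e => cm e / pe e) x =
      ∑ e ∈ U, (cp e * sameLabel x e + cm e * (1 - sameLabel x e)) * inverseWeight pe F e := by
  classical
  unfold labelScore inverseWeight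
  rw [← Finset.sum_subset hF (fun e _ he => by rw [if_neg he, mul_zero])]
  refine Finset.sum_congr rfl fun e he => ?_
  rw [if_pos he]
  ring

/-- The tail of a signed sum of the deviations of the sampled edge weights. The constant `29 / 50`
is that of `exp_le_one_add_add_mul_sq`. -/
theorem bernoulliProb_edge_tail {U : Finset (Sym2 V)} {w pe : Sym2 V → ℝ} {s ε W μ τ : ℝ}
    (hw : ∀ e ∈ U, 0 ≤ w e) (hW : W = ∑ e ∈ U, w e) (hWpos : 0 < W) (hs : 0 < s) (hε : 0 < ε)
    (hε1 : ε < 1) (hpe : ∀ e, pe e = min 1 (8 * s * w e / (ε ^ 2 * W))) (hμ : 0 < μ)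
    (hμ1 : μ ≤ 2 / 5) {a : Sym2 V → ℝ} (ha : ∀ e ∈ U, |a e| ≤ 1) :
    bernoulliProb U pe (fun F => τ * ε * W ≤ ∑ e ∈ U, a e * w e * (inverseWeight pe F e - 1)) ≤
      Real.exp (-(8 * μ * τ * s) + 29 / 50 * (8 * μ ^ 2 * s)) := by
  have hp : ∀ e ∈ U, 0 ≤ pe e ∧ pe e ≤ 1 := fun e he => by
    rw [hpe]
    have := hw e he
    exact ⟨le_min zero_le_one (by positivity), min_le_left _ _⟩
  set l : ℝ := 8 * μ * s / (ε * W) with hl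
  have hlpos : 0 < l := by positivity
  have h := bernoulliProb_centred_le hp (K := 29 / 50) (r := 2 / 5) (by norm_num)
    (fun u hu => exp_le_one_add_add_mul_sq hu) (c := fun e => l * (a e * w e))
    (v := fun e => 8 * μ ^ 2 * s / W * w e) (fun e he => by have := hw e he; positivity)
    (fun e he => by
      by_cases h1 : 1 ≤ 8 * s * w e / (ε ^ 2 * W)
      · left; rw [hpe, min_eq_left h1]
      · right
        have hwe := hw e he
        rw [hpe, min_eq_right (not_le.1 h1).le]
        have hlw : l * w e = μ * ε * (8 * s * w e / (ε ^ 2 * W)) := by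
          rw [hl]; field_simp
        have hq : 0 ≤ 8 * s * w e / (ε ^ 2 * W) := by positivity
        have hμε : μ * ε ≤ 2 / 5 := by nlinarith
        have habs : |l * (a e * w e)| ≤ l * w e := by
          rw [abs_mul, abs_mul, abs_of_pos hlpos, abs_of_nonneg hwe]
          have := ha e he
          have : |a e| * w e ≤ 1 * w e := by gcongr
          nlinarith
        refine ⟨habs.trans ?_, ?_⟩
        · rw [hlw]; gcongr
        · calc (l * (a e * w e)) ^ 2 = |l * (a e * w e)| ^ 2 := (sq_abs _).symm
            _ ≤ (l * w e) ^ 2 := by gcongr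
            _ = 8 * s * w e / (ε ^ 2 * W) * (8 * μ ^ 2 * s / W * w e) := by
              rw [hl]; field_simp)
    (8 * μ * τ * s)
  rw [← Finset.mul_sum, ← hW, div_mul_cancel₀ _ hWpos.ne'] at h
  refine le_trans (bernoulliProb_mono hp fun F _ hF => ?_) h
  have h2 : ∑ e ∈ U, l * (a e * w e) * (inverseWeight pe F e - 1) =
      l * ∑ e ∈ U, a e * w e * (inverseWeight pe F e - 1) := by
    rw [Finset.mul_sum]
    exact Finset.sum_congr rfl fun e _ => by ring
  rw [h2]
  calc 8 * μ * τ * s = l * (τ * ε * W) := by rw [hl]; field_simp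
    _ ≤ _ := by gcongr

/-- The expected number of kept edges is at most `8 * s / ε ^ 2`; three times as many are
unlikely. -/
theorem bernoulliProb_card_edges {U : Finset (Sym2 V)} {w pe : Sym2 V → ℝ} {s ε W : ℝ}
    (hw : ∀ e ∈ U, 0 ≤ w e) (hW : W = ∑ e ∈ U, w e) (hWpos : 0 < W) (hs : 0 < s) (hε : 0 < ε)
    (hpe : ∀ e, pe e = min 1 (8 * s * w e / (ε ^ 2 * W))) :
    bernoulliProb U pe (fun F => 24 * s / ε ^ 2 ≤ F.card) ≤ Real.exp (-(8 * s / ε ^ 2)) := by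
  classical
  have hp : ∀ e ∈ U, 0 ≤ pe e ∧ pe e ≤ 1 := fun e he => by
    rw [hpe]
    have := hw e he
    exact ⟨le_min zero_le_one (by positivity), min_le_left _ _⟩
  have h := bernoulliProb_le_prod hp (fun _ => 1) (fun _ => 0) (24 * s / ε ^ 2)
  refine le_trans (bernoulliProb_mono hp fun F hF hev => ?_) (h.trans ?_)
  · refine hev.trans (le_of_eq ?_)
    simp only [Finset.sum_ite_mem, Finset.sum_const, nsmul_eq_mul, mul_one]
    congr 2
    ext e
    simp only [Finset.mem_inter]
    exact ⟨fun h => ⟨hF h, h⟩, fun h => h.2⟩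
  · have he : Real.exp 1 ≤ 3 := by linarith [Real.exp_one_lt_d9]
    have h1 : ∏ e ∈ U, (pe e * Real.exp 1 + (1 - pe e) * Real.exp 0) ≤
        ∏ e ∈ U, Real.exp (2 * (8 * s / (ε ^ 2 * W)) * w e) := by
      refine Finset.prod_le_prod (fun e he' => ?_) fun e he' => ?_
      · have h0 := (hp e he').1
        have h1 : 0 ≤ 1 - pe e := by linarith [(hp e he').2]
        positivity
      · have h0 := (hp e he').1
        have h2 : pe e ≤ 8 * s / (ε ^ 2 * W) * w e := by
          rw [hpe]
          exact (min_le_right _ _).trans (le_of_eq (by ring))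
        have h3 := Real.add_one_le_exp (2 * (8 * s / (ε ^ 2 * W)) * w e)
        rw [Real.exp_zero]
        nlinarith
    calc _ ≤ Real.exp (-(24 * s / ε ^ 2)) *
        ∏ e ∈ U, Real.exp (2 * (8 * s / (ε ^ 2 * W)) * w e) := by gcongr
      _ = Real.exp (-(8 * s / ε ^ 2)) := by
        rw [← Real.exp_sum, ← Finset.mul_sum, ← hW, ← Real.exp_add]
        congr 1
        field_simp
        ring

/-- The number of sign vectors on `k` vertices is outweighed by the tail bound of
`bernoulliProb_edge_tail` at `μ = 2 / 5`, `τ = 19 / 40`, with an exponent of `0.7776 * k`, as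
`log 2 < 0.7`. -/
theorem two_pow_mul_exp_le (k : ℕ) :
    (2 : ℝ) ^ k * Real.exp (-(8 * (2 / 5) * (19 / 40) * k) + 29 / 50 * (8 * (2 / 5) ^ 2 * k)) ≤
      Real.exp (-(k / 4000)) := by
  have h2 : (2 : ℝ) ≤ Real.exp (7 / 10) := by
    have h := Real.log_two_lt_d9
    rw [← Real.log_le_iff_le_exp (by norm_num)]
    linarith
  calc _ ≤ (Real.exp (7 / 10)) ^ k *
        Real.exp (-(8 * (2 / 5) * (19 / 40) * k) + 29 / 50 * (8 * (2 / 5) ^ 2 * k)) := by gcongr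
    _ ≤ _ := by
      rw [← Real.exp_nat_mul, ← Real.exp_add, Real.exp_le_exp]
      have : (0 : ℝ) ≤ k := Nat.cast_nonneg k
      linarith

/-- Edge sampling preserves the maximum score up to a factor close to `1 + ε`, and keeps
`O(s / ε ^ 2)` edges, where `s` is the number of vertices. The upper bound for all labellings comes
from a union bound over the `2 ^ s` sign vectors, whatever the number of labels. -/
theorem bernoulliProb_edge_sampling [Fintype V] [Fintype Λ] [Nonempty Λ] {S : Finset V}
    {U : Finset (Sym2 V)} (hU : ∀ e ∈ U, ∀ v ∈ e, v ∈ S) {cp cm w pe : Sym2 V → ℝ} {ε W : ℝ}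
    (hcp : ∀ e ∈ U, 0 ≤ cp e) (hcm : ∀ e ∈ U, 0 ≤ cm e) (hcc : ∀ e ∈ U, cp e = 0 ∨ cm e = 0)
    (hw : ∀ e ∈ U, w e = cp e + cm e) (hW : W = ∑ e ∈ U, w e) (hWpos : 0 < W)
    (hε : 0 < ε) (hε1 : ε < 1)
    (hpe : ∀ e, pe e = min 1 (8 * S.card * w e / (ε ^ 2 * W)))
    (hhalf : W / 2 ≤ maxLabelScore Λ U cp cm) :
    bernoulliProb U pe (fun F => ¬ ((1 - ε / 50) * maxLabelScore Λ U cp cm ≤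
        maxLabelScore Λ F (fun e => cp e / pe e) (fun e => cm e / pe e) ∧
      maxLabelScore Λ F (fun e => cp e / pe e) (fun e => cm e / pe e) ≤
        (1 + 97 / 100 * ε) * maxLabelScore Λ U cp cm ∧
      (F.card : ℝ) ≤ 24 * S.card / ε ^ 2)) ≤ 4 * Real.exp (-(S.card / 4000)) := by
  classical
  have hw0 : ∀ e ∈ U, 0 ≤ w e := fun e he => by
    rw [hw e he]; exact add_nonneg (hcp e he) (hcm e he)
  have hs : (0 : ℝ) < S.card := by
    rw [Nat.cast_pos, Finset.card_pos]
    have hUne : U.Nonempty := by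
      rw [Finset.nonempty_iff_ne_empty]
      rintro rfl
      simp at hW
      linarith
    obtain ⟨e, he⟩ := hUne
    induction e using Sym2.ind with
    | h i j => exact ⟨i, hU _ he i (Sym2.mem_mk_left i j)⟩
  have hp : ∀ e ∈ U, 0 ≤ pe e ∧ pe e ≤ 1 := fun e he => by
    rw [hpe]
    have := hw0 e he
    exact ⟨le_min zero_le_one (by positivity), min_le_left _ _⟩
  set M := maxLabelScore Λ U cp cm with hM
  obtain ⟨x₀, hx₀⟩ := exists_labelScore_eq_max (Λ := Λ) U cp cm
  -- the coefficients of the four deviations to be controlled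
  let aNeg : Sym2 V → ℝ := fun e => if cp e = 0 then 1 else 0
  let aSgn : Finset V → Sym2 V → ℝ := fun A e =>
    (if cp e = 0 then -1 else 1) * (2 * sameLabel (fun v => v ∈ A) e - 1)
  let aOpt : Sym2 V → ℝ := fun e => -(if cp e = 0 then 1 - sameLabel x₀ e else sameLabel x₀ e)
  have hNeg : ∀ e ∈ U, aNeg e * w e = cm e := fun e he => by
    rw [hw e he]
    rcases hcc e he with h | h
    · simp [aNeg, h]
    · by_cases h' : cp e = 0 <;> simp [aNeg, h', h]
  have hSgn : ∀ A, ∀ e ∈ U, aSgn A e * w e =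
      (cp e - cm e) * (2 * sameLabel (fun v => v ∈ A) e - 1) := fun A e he => by
    rw [hw e he]
    rcases hcc e he with h | h
    · simp [aSgn, h]; ring
    · by_cases h' : cp e = 0
      · simp [aSgn, h', h]
      · simp [aSgn, h', h]; ring
  have hOpt : ∀ e ∈ U, aOpt e * w e =
      -(cp e * sameLabel x₀ e + cm e * (1 - sameLabel x₀ e)) := fun e he => by
    rw [hw e he]
    rcases hcc e he with h | h
    · simp [aOpt, h]; ring
    · by_cases h' : cp e = 0
      · simp [aOpt, h', h]
      · simp [aOpt, h', h]; ring
  have b1 := bernoulliProb_edge_tail (τ := 1 / 100) hw0 hW hWpos hs hε hε1 hpe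
    (μ := 1 / 200) (by norm_num) (by norm_num) (a := aNeg) (fun e _ => by
      simp only [aNeg]; split_ifs <;> norm_num)
  have b2 : ∀ A ∈ S.powerset, _ := fun A _ =>
    bernoulliProb_edge_tail (τ := 19 / 40) hw0 hW hWpos hs hε hε1 hpe
    (μ := 2 / 5) (by norm_num) (by norm_num) (a := aSgn A) (fun e _ => by
      simp only [aSgn, sameLabel]; split_ifs <;> norm_num)
  have b3 := bernoulliProb_edge_tail (τ := 1 / 100) hw0 hW hWpos hs hε hε1 hpe
    (μ := 1 / 200) (by norm_num) (by norm_num) (a := aOpt) (fun e _ => by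
      simp only [aOpt, sameLabel]; split_ifs <;> norm_num)
  have b4 := bernoulliProb_card_edges hw0 hW hWpos hs hε hpe
  have b2' := (bernoulliProb_exists_le hp S.powerset _).trans (Finset.sum_le_card_nsmul _ _ _ b2)
  rw [Finset.card_powerset, nsmul_eq_mul, Nat.cast_pow, Nat.cast_ofNat] at b2'
  replace b2' := b2'.trans (two_pow_mul_exp_le S.card)
  have e1 : Real.exp (-(8 * (1 / 200) * (1 / 100) * (S.card : ℝ)) +
      29 / 50 * (8 * (1 / 200) ^ 2 * S.card)) ≤ Real.exp (-(S.card / 4000)) := by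
    rw [Real.exp_le_exp]; linarith
  have e4 : Real.exp (-(8 * (S.card : ℝ) / ε ^ 2)) ≤ Real.exp (-(S.card / 4000)) := by
    rw [Real.exp_le_exp, neg_le_neg_iff]
    have : ε ^ 2 ≤ 1 := by nlinarith
    rw [le_div_iff₀ (by positivity)]
    nlinarith
  have hor := (bernoulliProb_or_le hp _ _).trans (add_le_add (b1.trans e1)
    ((bernoulliProb_or_le hp _ _).trans (add_le_add b2'
      ((bernoulliProb_or_le hp _ _).trans (add_le_add (b3.trans e1) (b4.trans e4))))))
  refine le_trans (bernoulliProb_mono hp fun F hF => ?_) (hor.trans (le_of_eq (by ring)))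
  contrapose!
  rintro ⟨g1, g2, g3, g4⟩
  rw [Finset.sum_congr rfl fun e he => by rw [hNeg e he]] at g1
  rw [Finset.sum_congr rfl fun e he => by rw [hOpt e he]] at g3
  have hscore : ∀ x : V → Λ, labelScore F (fun e => cp e / pe e) (fun e => cm e / pe e) x =
      labelScore U cp cm x + ∑ e ∈ U, cm e * (inverseWeight pe F e - 1) +
        ∑ e ∈ U, ((cp e - cm e) * (inverseWeight pe F e - 1)) * sameLabel x e := fun x => by
    rw [labelScore_sampled hF, labelScore, ← Finset.sum_add_distrib, ← Finset.sum_add_distrib]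
    exact Finset.sum_congr rfl fun e _ => by ring
  have hsign : ∀ x : V → Λ, ∑ e ∈ U, ((cp e - cm e) * (inverseWeight pe F e - 1)) * sameLabel x e ≤
      19 / 40 * ε * W := fun x => by
    refine sum_mul_sameLabel_le_of_signs U _ (fun σ => ?_) x
    have := g2 (S.filter fun v => σ v = 1) (Finset.mem_powerset.2 (Finset.filter_subset _ _))
    refine le_of_eq_of_le (Finset.sum_congr rfl fun e he => ?_) this.le
    rw [hSgn _ e he]
    have hsame : sameLabel (fun v => v ∈ S.filter fun v => σ v = 1) e = sameLabel σ e := by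
      refine sameLabel_congr fun v hv u hu => ?_
      simp only [Finset.mem_filter, hU e he v hv, hU e he u hu, true_and, eq_iff_iff]
      generalize σ v = a
      generalize σ u = b
      revert a b
      decide
    rw [hsame]
    ring
  refine ⟨?_, ?_, g4.le⟩
  · refine le_trans ?_ (labelScore_le_max F _ _ x₀)
    rw [labelScore_sampled hF]
    have : ∑ e ∈ U, -(cp e * sameLabel x₀ e + cm e * (1 - sameLabel x₀ e)) *
        (inverseWeight pe F e - 1) = M - ∑ e ∈ U, (cp e * sameLabel x₀ e +
          cm e * (1 - sameLabel x₀ e)) * inverseWeight pe F e := by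
      rw [hM, ← hx₀, labelScore, ← Finset.sum_sub_distrib]
      exact Finset.sum_congr rfl fun e _ => by ring
    rw [this] at g3
    nlinarith
  · refine ciSup_le fun x => ?_
    rw [hscore]
    have := labelScore_le_max U cp cm x
    have := hsign x
    nlinarith

end EdgeSampling

/-! ### Fractional labellings and minimax duality -/

section Duality

variable {V : Type*} {q : ℕ}

/-- The fractional labelling given by a labelling. -/
def oneHot (x : V → Fin q) (i : V) (c : Fin q) : ℝ := if x i = c then 1 else 0

theorem sum_oneHot_mul (x : V → Fin q) (i : V) (f : Fin q → ℝ) :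
    ∑ c, oneHot x i c * f c = f (x i) := by
  simp [oneHot]

theorem oneHot_nonneg (x : V → Fin q) (i : V) (c : Fin q) : 0 ≤ oneHot x i c := by
  unfold oneHot; split_ifs <;> norm_num

theorem oneHot_le_one (x : V → Fin q) (i : V) (c : Fin q) : oneHot x i c ≤ 1 := by
  unfold oneHot; split_ifs <;> norm_num

theorem oneHot_mem_stdSimplex (x : V → Fin q) (i : V) : oneHot x i ∈ stdSimplex ℝ (Fin q) :=
  ⟨oneHot_nonneg x i, by simpa using sum_oneHot_mul x i fun _ => 1⟩

variable [Fintype V]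

/-- The matrix `η`, applied separately for every label. -/
def labelAct (η : V → V → ℝ) (X : V → Fin q → ℝ) (i : V) (c : Fin q) : ℝ := ∑ j, η i j * X j c

/-- The bilinear form of the matrix `η` on fractional labellings. -/
def labelForm (η : V → V → ℝ) (X Y : V → Fin q → ℝ) : ℝ := ∑ i, ∑ c, X i c * labelAct η Y i c

theorem labelForm_comm {η : V → V → ℝ} (hη : ∀ i j, η i j = η j i) (X Y : V → Fin q → ℝ) :
    labelForm η X Y = labelForm η Y X := by
  unfold labelForm labelAct
  simp only [Finset.mul_sum]
  rw [Finset.sum_congr rfl fun i _ => Finset.sum_comm, Finset.sum_comm]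
  refine Finset.sum_congr rfl fun j _ => ?_
  rw [Finset.sum_comm]
  refine Finset.sum_congr rfl fun c _ => Finset.sum_congr rfl fun i _ => ?_
  rw [hη]; ring

theorem labelAct_add (η : V → V → ℝ) (X Y : V → Fin q → ℝ) (i : V) (c : Fin q) :
    labelAct η (X + Y) i c = labelAct η X i c + labelAct η Y i c := by
  simp [labelAct, mul_add, Finset.sum_add_distrib]

theorem labelAct_smul (η : V → V → ℝ) (s : ℝ) (X : V → Fin q → ℝ) (i : V) (c : Fin q) :
    labelAct η (s • X) i c = s * labelAct η X i c := by
  simp only [labelAct, Pi.smul_apply, smul_eq_mul, Finset.mul_sum]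
  exact Finset.sum_congr rfl fun j _ => by ring

theorem labelForm_add_left (η : V → V → ℝ) (X Y Z : V → Fin q → ℝ) :
    labelForm η (X + Y) Z = labelForm η X Z + labelForm η Y Z := by
  simp [labelForm, add_mul, Finset.sum_add_distrib]

theorem labelForm_add_right (η : V → V → ℝ) (X Y Z : V → Fin q → ℝ) :
    labelForm η Z (X + Y) = labelForm η Z X + labelForm η Z Y := by
  simp [labelForm, labelAct_add, mul_add, Finset.sum_add_distrib]

theorem labelForm_oneHot_left (η : V → V → ℝ) (x : V → Fin q) (Y : V → Fin q → ℝ) :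
    labelForm η (oneHot x) Y = ∑ i, labelAct η Y i (x i) :=
  Finset.sum_congr rfl fun i _ => sum_oneHot_mul x i _

/-- A fractional labelling can be rounded, vertex by vertex, without decreasing the form: as the
diagonal of `η` vanishes, the form is affine in the fractional label of each vertex. -/
theorem exists_rounding [NeZero q] {η : V → V → ℝ} (hη : ∀ i j, η i j = η j i)
    (hdiag : ∀ i, η i i = 0) (X : V → Fin q → ℝ) (hX : ∀ i, X i ∈ stdSimplex ℝ (Fin q)) :
    ∃ x : V → Fin q, labelForm η X X ≤ labelForm η (oneHot x) (oneHot x) := by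
  classical
  suffices h : ∀ A : Finset V, ∃ Y : V → Fin q → ℝ, (∀ i, Y i ∈ stdSimplex ℝ (Fin q)) ∧
      (∀ i ∈ A, ∃ c, Y i = Pi.single c 1) ∧ labelForm η X X ≤ labelForm η Y Y by
    obtain ⟨Y, _, h2, h3⟩ := h Finset.univ
    choose! x hx using h2
    refine ⟨x, ?_⟩
    have : Y = oneHot x := by
      funext i c
      rw [hx i (Finset.mem_univ i)]
      simp [oneHot, Pi.single_apply, eq_comm]
    rwa [← this]
  intro A
  induction A using Finset.induction_on with
  | empty => exact ⟨X, hX, by simp, le_rfl⟩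
  | insert a A ha ih =>
    obtain ⟨Y, h1, h2, h3⟩ := ih
    obtain ⟨c, hc⟩ := Finite.exists_max (fun c => labelAct η Y a c)
    let D : V → Fin q → ℝ := Pi.single a (Pi.single c 1 - Y a)
    have hDa : D a = Pi.single c 1 - Y a := by simp [D]
    have hDi : ∀ i, i ≠ a → D i = 0 := fun i hi => by simp [D, hi]
    have hD : ∀ Z, labelForm η D Z = ∑ c', D a c' * labelAct η Z a c' := fun Z => by
      unfold labelForm
      rw [Finset.sum_eq_single a]
      · intro i _ hi; simp [hDi i hi]
      · simp
    have hDD : labelForm η D D = 0 := by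
      rw [hD]
      refine Finset.sum_eq_zero fun c' _ => ?_
      unfold labelAct
      rw [Finset.sum_eq_single a]
      · simp [hdiag]
      · intro i _ hi; simp [hDi i hi]
      · simp
    have hDY : 0 ≤ labelForm η D Y := by
      rw [hD, hDa]
      simp only [Pi.sub_apply, sub_mul, Finset.sum_sub_distrib, Pi.single_apply, ite_mul, one_mul,
        zero_mul, Finset.sum_ite_eq', Finset.mem_univ, if_true]
      rw [sub_nonneg]
      calc ∑ c', Y a c' * labelAct η Y a c' ≤ ∑ c', Y a c' * labelAct η Y a c :=
            Finset.sum_le_sum fun c' _ => mul_le_mul_of_nonneg_left (hc c') ((h1 a).1 c')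
        _ = labelAct η Y a c := by rw [← Finset.sum_mul, (h1 a).2, one_mul]
    refine ⟨Y + D, fun i => ?_, fun i hi => ?_, ?_⟩
    · by_cases hia : i = a
      · subst hia
        have : (Y + D) i = Pi.single c 1 := by rw [Pi.add_apply, hDa]; abel
        rw [this]
        exact single_mem_stdSimplex ℝ c
      · rw [Pi.add_apply, hDi i hia, add_zero]
        exact h1 i
    · by_cases hia : i = a
      · subst hia
        exact ⟨c, by rw [Pi.add_apply, hDa]; abel⟩
      · obtain ⟨c', hc'⟩ := h2 i (Finset.mem_of_mem_insert_of_ne hi hia)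
        exact ⟨c', by rw [Pi.add_apply, hDi i hia, add_zero, hc']⟩
    · rw [labelForm_add_left, labelForm_add_right, labelForm_add_right, hDD,
        labelForm_comm hη Y D]
      linarith

/-- Linear programming duality for labellings with prescribed estimates `ρ` of the numbers
`labelAct η x`: some dual vector `z` certifies that no labelling beats the maximum of the form.
The constraint that the estimates be correct enters as an `ℓ¹` penalty, which keeps `z` in
`[-1, 1]`. -/
theorem exists_dual_certificate [NeZero q] {η : V → V → ℝ} (hη : ∀ i j, η i j = η j i)
    (hdiag : ∀ i, η i i = 0) (ρ : V → Fin q → ℝ) :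
    ∃ z : V → Fin q → ℝ, (∀ i c, |z i c| ≤ 1) ∧ ∀ x : V → Fin q,
      ∑ i, (ρ i (x i) - labelAct η z i (x i)) + ∑ i, ∑ c, z i c * ρ i c ≤
        ⨆ x : V → Fin q, labelForm η (oneHot x) (oneHot x) := by
  classical
  let X : Set (V → Fin q → ℝ) := Set.Icc (-1) 1
  let Y : Set (V → Fin q → ℝ) := Set.pi Set.univ fun _ => stdSimplex ℝ (Fin q)
  let f : (V → Fin q → ℝ) → (V → Fin q → ℝ) → ℝ := fun z x =>
    ∑ i, ∑ c, (x i c * ρ i c + z i c * (ρ i c - labelAct η x i c))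
  have hX : Convex ℝ X := convex_Icc _ _
  have hY : Convex ℝ Y := convex_pi fun _ _ => convex_stdSimplex ℝ _
  have hYne : Y.Nonempty := ⟨oneHot fun _ => 0, fun i _ => oneHot_mem_stdSimplex _ i⟩
  have hcont1 : ∀ x, Continuous fun z => f z x := fun x => by
    simp only [f]; fun_prop
  have hcont2 : ∀ z, Continuous fun x => f z x := fun z => by
    simp only [f, labelAct]; fun_prop
  have haff1 : ∀ x (a b : V → Fin q → ℝ) (s t : ℝ), s + t = 1 →
      f (s • a + t • b) x = s • f a x + t • f b x := fun x a b s t hst => by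
    simp only [f, smul_eq_mul, Finset.mul_sum, ← Finset.sum_add_distrib]
    refine Finset.sum_congr rfl fun i _ => Finset.sum_congr rfl fun c _ => ?_
    simp only [Pi.add_apply, Pi.smul_apply, smul_eq_mul]
    linear_combination (-(x i c * ρ i c)) * hst
  have haff2 : ∀ z (a b : V → Fin q → ℝ) (s t : ℝ), s + t = 1 →
      f z (s • a + t • b) = s • f z a + t • f z b := fun z a b s t hst => by
    simp only [f, smul_eq_mul, Finset.mul_sum, ← Finset.sum_add_distrib]
    refine Finset.sum_congr rfl fun i _ => Finset.sum_congr rfl fun c _ => ?_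
    simp only [labelAct_add, labelAct_smul, Pi.add_apply, Pi.smul_apply, smul_eq_mul]
    linear_combination (-(z i c * ρ i c)) * hst
  obtain ⟨z, hz, x₀, hx₀, hsaddle⟩ := Sion.exists_isSaddlePointOn (X := X) (Y := Y) (f := f)
    (Set.nonempty_Icc.2 fun _ _ => by norm_num) hX isCompact_Icc
    (fun x _ => (hcont1 x).lowerSemicontinuous.lowerSemicontinuousOn _)
    (fun x _ => ConvexOn.quasiconvexOn ⟨hX, fun a _ b _ s t _ _ hst => (haff1 x a b s t hst).le⟩)
    hY hYne (isCompact_univ_pi fun _ => isCompact_stdSimplex ℝ _)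
    (fun z _ => (hcont2 z).upperSemicontinuous.upperSemicontinuousOn _)
    (fun z _ => ConcaveOn.quasiconcaveOn ⟨hY, fun a _ b _ s t _ _ hst => (haff2 z a b s t hst).ge⟩)
  refine ⟨z, fun i c => abs_le.2 ⟨hz.1 i c, hz.2 i c⟩, fun x => ?_⟩
  have h1 : f z (oneHot x) = ∑ i, (ρ i (x i) - labelAct η z i (x i)) + ∑ i, ∑ c, z i c * ρ i c := by
    have : f z (oneHot x) = labelForm η (oneHot x) 0 + ∑ i, ∑ c, oneHot x i c * ρ i c
        + ∑ i, ∑ c, z i c * ρ i c - labelForm η z (oneHot x) := by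
      simp only [f, labelForm, labelAct, ← Finset.sum_add_distrib, ← Finset.sum_sub_distrib]
      refine Finset.sum_congr rfl fun i _ => Finset.sum_congr rfl fun c _ => ?_
      simp only [Pi.zero_apply, mul_zero, Finset.sum_const_zero]
      ring
    rw [this, labelForm_comm hη z, labelForm_oneHot_left, labelForm_oneHot_left]
    simp only [sum_oneHot_mul, labelAct, Pi.zero_apply, mul_zero, Finset.sum_const_zero,
      Finset.sum_sub_distrib]
    ring
  rw [← h1]
  -- the best penalty against the optimal fractional labelling
  let z' : V → Fin q → ℝ := fun i c => if ρ i c - labelAct η x₀ i c ≤ 0 then 1 else -1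
  have hz' : z' ∈ X := by
    constructor
    · intro i c; simp only [z', Pi.neg_apply, Pi.one_apply]; split_ifs <;> norm_num
    · intro i c; simp only [z', Pi.one_apply]; split_ifs <;> norm_num
  have h2 : f z' x₀ ≤ labelForm η x₀ x₀ := by
    refine Finset.sum_le_sum fun i _ => Finset.sum_le_sum fun c _ => ?_
    have hx : x₀ i ∈ stdSimplex ℝ (Fin q) := hx₀ i (Set.mem_univ i)
    have hx0 : 0 ≤ x₀ i c := hx.1 c
    have hx1 : x₀ i c ≤ 1 := by
      rw [← hx.2]; exact Finset.single_le_sum (fun c _ => hx.1 c) (Finset.mem_univ c)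
    simp only [z']
    split_ifs with h <;> nlinarith
  obtain ⟨y, hy⟩ := exists_rounding hη hdiag x₀ fun i => hx₀ i (Set.mem_univ i)
  calc f z (oneHot x) ≤ f z' x₀ := hsaddle z' hz' _ fun i _ => oneHot_mem_stdSimplex x i
    _ ≤ _ := h2.trans (hy.trans (le_ciSup
      (Set.finite_range fun x : V → Fin q => labelForm η (oneHot x) (oneHot x)).bddAbove y))

end Duality

/-! ### Sparse approximation of the vectors `labelAct η (y * x)` -/

section SparseApproximation

/-- Maurey's empirical method in a weighted `ℓ²` space: a convex combination `r` of vectors `v j`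
is approximated by the average of `k` of them, chosen with repetition. -/
theorem exists_empirical_approx {J I : Type*} [Fintype J] [Fintype I] {π : J → ℝ}
    (hπ : ∀ j, 0 ≤ π j) (hπ1 : ∑ j, π j = 1) (v : J → I → ℝ) {u : I → ℝ} (hu : ∀ i, 0 ≤ u i)
    {B : ℝ} (hB : ∑ j, π j * ∑ i, u i * v j i ^ 2 ≤ B) (k : ℕ) :
    ∃ R : Fin k → J, ∑ i, u i * (∑ l, v (R l) i - k * ∑ j, π j * v j i) ^ 2 ≤ k * B := by
  induction k with
  | zero => exact ⟨Fin.elim0, by simp⟩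
  | succ k ih =>
    obtain ⟨R, hR⟩ := ih
    set r : I → ℝ := fun i => ∑ j, π j * v j i with hr
    set s : I → ℝ := fun i => ∑ l, v (R l) i - k * r i with hs
    have hexp : ∑ j, π j * ∑ i, u i * (s i + (v j i - r i)) ^ 2 ≤ (k + 1) * B := by
      have h1 : ∑ j, π j * ∑ i, u i * (s i + (v j i - r i)) ^ 2 =
          ∑ i, u i * (s i ^ 2 - r i ^ 2) + ∑ j, π j * ∑ i, u i * v j i ^ 2 := by
        simp only [Finset.mul_sum]
        rw [Finset.sum_comm, Finset.sum_comm (f := fun j i => π j * (u i * v j i ^ 2)),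
          ← Finset.sum_add_distrib]
        refine Finset.sum_congr rfl fun i _ => ?_
        have h2 : ∑ j, π j * (u i * (s i + (v j i - r i)) ^ 2) =
            u i * (s i - r i) ^ 2 * ∑ j, π j + 2 * u i * (s i - r i) * ∑ j, π j * v j i +
              ∑ j, π j * (u i * v j i ^ 2) := by
          rw [Finset.mul_sum, Finset.mul_sum, ← Finset.sum_add_distrib, ← Finset.sum_add_distrib]
          exact Finset.sum_congr rfl fun j _ => by ring
        rw [h2, hπ1]
        change u i * (s i - r i) ^ 2 * 1 + 2 * u i * (s i - r i) * r i + _ = _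
        ring
      have h3 : ∑ i, u i * (s i ^ 2 - r i ^ 2) ≤ ∑ i, u i * s i ^ 2 :=
        Finset.sum_le_sum fun i _ =>
          mul_le_mul_of_nonneg_left (by linarith [sq_nonneg (r i)]) (hu i)
      rw [h1]
      linarith
    -- some value is at most the average
    obtain ⟨j, hj⟩ : ∃ j, ∑ i, u i * (s i + (v j i - r i)) ^ 2 ≤ (k + 1) * B := by
      by_contra! hcon
      obtain ⟨j₀, hj₀⟩ : ∃ j, 0 < π j := by
        by_contra! h
        have : ∑ j, π j ≤ 0 := Finset.sum_nonpos fun j _ => h j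
        linarith
      have : ∑ j, π j * ((k + 1) * B) < ∑ j, π j * ∑ i, u i * (s i + (v j i - r i)) ^ 2 :=
        Finset.sum_lt_sum (fun j _ => mul_le_mul_of_nonneg_left (hcon j).le (hπ j))
          ⟨j₀, Finset.mem_univ _, mul_lt_mul_of_pos_left (hcon j₀) hj₀⟩
      rw [← Finset.sum_mul, hπ1, one_mul] at this
      linarith
    refine ⟨Fin.cons j R, ?_⟩
    push_cast
    refine le_of_eq_of_le (Finset.sum_congr rfl fun i _ => ?_) hj
    rw [Fin.sum_univ_succ]
    simp only [Fin.cons_zero, Fin.cons_succ, hs]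
    ring

variable {V : Type*} {q : ℕ}

/-- The contribution of one seed, a vertex with a label, to the estimate at `(i, c)`; the seed
`none` contributes nothing. -/
noncomputable def seedVector (η : V → V → ℝ) (g : V → ℝ) (T : ℝ) (s : Option (V × Fin q)) (i : V)
    (c : Fin q) : ℝ :=
  s.elim 0 fun z => if z.2 = c then T / g z.1 * η i z.1 else 0

/-- The estimate of a vector `labelAct η (y * x)` that is determined by a sequence of `k` labelled
vertices, truncated to `[-2 g i, 2 g i]`. -/
noncomputable def seedEstimate (η : V → V → ℝ) (g : V → ℝ) (T : ℝ) {k : ℕ}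
    (R : Fin k → Option (V × Fin q)) (i : V) (c : Fin q) : ℝ :=
  max (-(2 * g i)) (min (2 * g i) ((∑ l, seedVector η g T (R l) i c) / k))

theorem abs_seedEstimate_le (η : V → V → ℝ) {g : V → ℝ} (hg : ∀ i, 0 < g i) (T : ℝ) {k : ℕ}
    (R : Fin k → Option (V × Fin q)) (i : V) (c : Fin q) :
    |seedEstimate η g T R i c| ≤ 2 * g i := by
  have := hg i
  exact abs_le.2 ⟨le_max_left _ _, max_le (by linarith) (min_le_left _ _)⟩

theorem abs_clip_sub_le {a b r : ℝ} (hr : |r| ≤ b) : |max (-b) (min b a) - r| ≤ |a - r| := by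
  rw [abs_le] at hr
  have h1 := le_abs_self (a - r)
  have h2 := neg_abs_le (a - r)
  rw [abs_le]
  rcases max_cases (-b) (min b a) with ⟨h, h'⟩ | ⟨h, h'⟩ <;>
  rcases min_cases b a with ⟨k, k'⟩ | ⟨k, k'⟩ <;>
  rw [h] <;> constructor <;> linarith

/-- The seed estimates form a net: they approximate the vectors `labelAct η (y * x)`, for all
labellings `x`, in the `ℓ¹` norm with weights `1 + y i`. -/
theorem exists_seedEstimate_near [Fintype V] {η ω : V → V → ℝ} {g y : V → ℝ} {n Δ κ : ℝ}
    (hn : n = Fintype.card V) (hnpos : 0 < n) (hΔ : 0 < Δ) (hκ : 0 < κ)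
    (hω1 : ∀ i j, ω i j ≤ 1) (hη : ∀ i j, |η i j| ≤ ω i j) (hωs : ∀ i j, ω i j = ω j i)
    (hg : ∀ i, 0 < g i)
    (hdeg : ∀ j, ∑ i, ω i j ≤ g j) (hy : ∀ i, 0 ≤ y i) (hy1 : ∑ i, y i ≤ 2 * n)
    (hy2 : ∑ i, y i * g i ≤ 4 * n * Δ) (hy3 : ∀ j, ∑ i, ω i j * y i ≤ 2 * g j) {k : ℕ}
    (hk : 72 * q * n ≤ k * Δ * κ ^ 2) (hk0 : 0 < k) (x : V → Fin q) :
    ∃ R : Fin k → Option (V × Fin q), ∑ i, ∑ c, (1 + y i) *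
      |seedEstimate η g (4 * n * Δ) R i c - labelAct η (fun j c => y j * oneHot x j c) i c| ≤
        κ * n * Δ := by
  classical
  have hω0 : ∀ i j, 0 ≤ ω i j := fun i j => (abs_nonneg _).trans (hη i j)
  have hk0' : (0 : ℝ) < k := Nat.cast_pos.2 hk0
  set T := 4 * n * Δ with hT
  have hTpos : 0 < T := by positivity
  set r : V → Fin q → ℝ := labelAct η (fun j c => y j * oneHot x j c) with hr
  -- sample `j` with probability `y j * g j / T`, and nothing with the remaining probability
  let π : Option V → ℝ := fun o => o.elim (1 - ∑ j, y j * g j / T) fun j => y j * g j / T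
  let lab : Option V → Option (V × Fin q) := fun o => o.map fun j => (j, x j)
  let v : Option V → V × Fin q → ℝ := fun o ic => seedVector η g T (lab o) ic.1 ic.2
  let u : V × Fin q → ℝ := fun ic => 1 + y ic.1
  have hu : ∀ ic, 0 ≤ u ic := fun ic => by have := hy ic.1; simp only [u]; linarith
  have hπ : ∀ o, 0 ≤ π o := by
    rintro (_ | j)
    · simp only [π, Option.elim_none]
      rw [← Finset.sum_div, sub_nonneg, div_le_one hTpos]
      exact hy2
    · have := hy j; have := hg j
      simp only [π, Option.elim_some]; positivity
  have hπ1 : ∑ o, π o = 1 := by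
    rw [Fintype.sum_option]; simp [π]
  have hv : ∀ j i c, v (some j) (i, c) = T / g j * η i j * oneHot x j c := fun j i c => by
    simp only [v, lab, Option.map_some, seedVector, Option.elim_some, oneHot]
    split_ifs <;> ring
  have hv0 : ∀ ic, v none ic = 0 := fun ic => by simp [v, lab, seedVector]
  have hmean : ∀ i c, ∑ o, π o * v o (i, c) = r i c := fun i c => by
    rw [Fintype.sum_option, hv0, mul_zero, zero_add, hr]
    refine Finset.sum_congr rfl fun j _ => ?_
    rw [hv]
    have := hg j
    simp only [π, Option.elim_some]
    field_simp
  have hvar : ∑ o, π o * ∑ ic, u ic * v o ic ^ 2 ≤ 24 * n ^ 2 * Δ := by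
    rw [Fintype.sum_option]
    simp only [hv0, ne_eq, OfNat.ofNat_ne_zero, not_false_eq_true, zero_pow, mul_zero,
      Finset.sum_const_zero, zero_add]
    have h1 : ∀ j, π (some j) * ∑ ic, u ic * v (some j) ic ^ 2 ≤ 3 * T * y j := fun j => by
      have hgj := hg j
      have h2 : ∑ ic, u ic * v (some j) ic ^ 2 ≤ (T / g j) ^ 2 * (3 * g j) := by
        rw [Fintype.sum_prod_type]
        have h3 : ∀ i, ∑ c, u (i, c) * v (some j) (i, c) ^ 2 ≤
            (T / g j) ^ 2 * (ω i j + ω i j * y i) := fun i => by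
          have h4 : ∑ c, u (i, c) * v (some j) (i, c) ^ 2 =
              (T / g j) ^ 2 * ((1 + y i) * η i j ^ 2) := by
            rw [← sum_oneHot_mul x j fun _ => (T / g j) ^ 2 * ((1 + y i) * η i j ^ 2)]
            refine Finset.sum_congr rfl fun c _ => ?_
            rw [hv]
            simp only [u, oneHot]
            split_ifs <;> ring
          rw [h4]
          have h5 : η i j ^ 2 ≤ ω i j := by
            rw [← sq_abs]
            have := hη i j; have := hω1 i j; have := abs_nonneg (η i j)
            nlinarith
          have := hy i
          gcongr
          nlinarith
        refine (Finset.sum_le_sum fun i _ => h3 i).trans ?_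
        rw [← Finset.mul_sum, Finset.sum_add_distrib]
        have := hdeg j; have := hy3 j
        gcongr
        linarith
      have hyj := hy j
      calc π (some j) * ∑ ic, u ic * v (some j) ic ^ 2
          ≤ (y j * g j / T) * ((T / g j) ^ 2 * (3 * g j)) :=
            mul_le_mul_of_nonneg_left h2 (hπ (some j))
        _ = 3 * T * y j := by field_simp
    refine (Finset.sum_le_sum fun j _ => h1 j).trans ?_
    rw [← Finset.mul_sum]
    nlinarith
  obtain ⟨R, hR⟩ := exists_empirical_approx hπ hπ1 v hu hvar k
  refine ⟨fun l => lab (R l), ?_⟩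
  let δ : V × Fin q → ℝ := fun ic =>
    (∑ l, seedVector η g T (lab (R l)) ic.1 ic.2) / k - r ic.1 ic.2
  have hδ : ∑ ic, u ic * δ ic ^ 2 ≤ 24 * n ^ 2 * Δ / k := by
    rw [le_div_iff₀ hk0']
    have : k * ∑ ic, u ic * δ ic ^ 2 * k =
        ∑ ic, u ic * (∑ l, v (R l) ic - k * ∑ j, π j * v j ic) ^ 2 := by
      rw [Finset.mul_sum]
      refine Finset.sum_congr rfl fun ic _ => ?_
      have h6 : ∑ j, π j * v j ic = r ic.1 ic.2 := hmean ic.1 ic.2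
      rw [h6]
      change _ = u ic * ((∑ l, seedVector η g T (lab (R l)) ic.1 ic.2) - k * r ic.1 ic.2) ^ 2
      simp only [δ]
      field_simp
    rw [← this] at hR
    rw [← Finset.sum_mul] at hR
    exact le_of_mul_le_mul_left hR hk0'
  have hCS : (∑ ic, u ic * |δ ic|) ^ 2 ≤ (κ * n * Δ) ^ 2 := by
    have h1 := Finset.sum_mul_sq_le_sq_mul_sq Finset.univ (fun ic => √(u ic))
      (fun ic => √(u ic) * |δ ic|)
    have h2 : ∀ ic, √(u ic) * (√(u ic) * |δ ic|) = u ic * |δ ic| := fun ic => by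
      rw [← mul_assoc, Real.mul_self_sqrt (hu ic)]
    have h3 : ∀ ic, (√(u ic) * |δ ic|) ^ 2 = u ic * δ ic ^ 2 := fun ic => by
      rw [mul_pow, Real.sq_sqrt (hu ic), sq_abs]
    have h4 : ∀ ic, √(u ic) ^ 2 = u ic := fun ic => Real.sq_sqrt (hu ic)
    simp only [h2, h3, h4] at h1
    have h5 : ∑ ic, u ic ≤ 3 * n * q := by
      rw [Fintype.sum_prod_type]
      simp only [u, Finset.sum_const, Finset.card_univ, Fintype.card_fin, nsmul_eq_mul]
      rw [← Finset.mul_sum, Finset.sum_add_distrib]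
      simp only [Finset.sum_const, Finset.card_univ, nsmul_eq_mul, mul_one, ← hn]
      have : (0 : ℝ) ≤ q := Nat.cast_nonneg q
      nlinarith
    have h6 : 0 ≤ ∑ ic, u ic * δ ic ^ 2 :=
      Finset.sum_nonneg fun ic _ => mul_nonneg (hu ic) (sq_nonneg _)
    calc _ ≤ (∑ ic, u ic) * ∑ ic, u ic * δ ic ^ 2 := h1
      _ ≤ (3 * n * q) * (24 * n ^ 2 * Δ / k) := by gcongr
      _ = (72 * q * n) * (n ^ 2 * Δ / k) := by ring
      _ ≤ (k * Δ * κ ^ 2) * (n ^ 2 * Δ / k) := by gcongr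
      _ = _ := by field_simp
  have hfin := abs_le_of_sq_le_sq hCS (by positivity)
  refine le_trans ?_ ((le_abs_self _).trans hfin)
  rw [Fintype.sum_prod_type]
  refine Finset.sum_le_sum fun i _ => Finset.sum_le_sum fun c _ => ?_
  refine mul_le_mul_of_nonneg_left (abs_clip_sub_le ?_) (hu (i, c))
  -- the exact vector is bounded by the sampled degree
  rw [hr]
  unfold labelAct
  refine (Finset.abs_sum_le_sum_abs _ _).trans ((Finset.sum_le_sum fun j _ => ?_).trans (hy3 i))
  rw [abs_mul, abs_mul, abs_of_nonneg (hy j), abs_of_nonneg (oneHot_nonneg x j c), hωs j i]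
  have h1 := hη i j
  have h2 := oneHot_le_one x j c
  have h3 := hy j
  have h4 := oneHot_nonneg x j c
  calc |η i j| * (y j * oneHot x j c) ≤ ω i j * (y j * 1) := by gcongr; exact hω0 i j
    _ = _ := by ring

end SparseApproximation

/-! ### Vertex sampling -/

section VertexSampling

variable {V : Type*} [Fintype V] {q : ℕ}

/-- The maximum over all labellings `x` with `q` labels of `∑ η i j * y i * y j` over the pairs
`i, j` with the same label. -/
noncomputable def maxLabelForm (q : ℕ) (η : V → V → ℝ) (y : V → ℝ) : ℝ :=
  ⨆ x : V → Fin q,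
    labelForm η (fun i c => y i * oneHot x i c) (fun i c => y i * oneHot x i c)

theorem labelForm_scaled_left (η : V → V → ℝ) (y : V → ℝ) (x : V → Fin q) (Y : V → Fin q → ℝ) :
    labelForm η (fun i c => y i * oneHot x i c) Y = ∑ i, y i * labelAct η Y i (x i) := by
  refine Finset.sum_congr rfl fun i _ => ?_
  rw [← sum_oneHot_mul x i fun c => y i * labelAct η Y i c]
  exact Finset.sum_congr rfl fun c _ => by ring

/-- Upper bound for the score of a labelling `x` of the sample with weights `y`, in terms of
estimates `ρ` and dual vectors `z`. The bound depends on the sample only through a linear function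
of `y` and the quality of the estimates. -/
theorem labelForm_scaled_le {η : V → V → ℝ} (hη : ∀ i j, η i j = η j i) {y : V → ℝ}
    (hy : ∀ i, 0 ≤ y i) {ρ z : V → Fin q → ℝ} (hz : ∀ i c, |z i c| ≤ 1) {m : V → ℝ}
    (hm : ∀ i c, ρ i c - labelAct η z i c ≤ m i) {v e : ℝ}
    (hv : ∑ i, m i + ∑ i, ∑ c, z i c * ρ i c ≤ v) (x : V → Fin q)
    (he : ∑ i, ∑ c, (1 + y i) *
      |ρ i c - labelAct η (fun j c => y j * oneHot x j c) i c| ≤ e) :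
    labelForm η (fun i c => y i * oneHot x i c) (fun i c => y i * oneHot x i c) ≤
      v + ∑ i, m i * (y i - 1) + e := by
  set r := labelAct η (fun j c => y j * oneHot x j c) with hr
  -- the dual vector moves the sample weights from one side of the form to the other
  have h1 : ∑ i, y i * labelAct η z i (x i) = ∑ i, ∑ c, z i c * r i c := by
    rw [← labelForm_scaled_left, labelForm_comm hη]
    rfl
  have h2 : ∑ i, y i * r i (x i) ≤
      ∑ i, y i * m i + ∑ i, y i * labelAct η z i (x i) + ∑ i, y i * |ρ i (x i) - r i (x i)| := by
    rw [← Finset.sum_add_distrib, ← Finset.sum_add_distrib]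
    refine Finset.sum_le_sum fun i _ => ?_
    have h := hm i (x i)
    have h' := neg_abs_le (ρ i (x i) - r i (x i))
    rw [← mul_add, ← mul_add]
    exact mul_le_mul_of_nonneg_left (by linarith) (hy i)
  have h3 : ∑ i, ∑ c, z i c * r i c ≤
      ∑ i, ∑ c, z i c * ρ i c + ∑ i, ∑ c, |ρ i c - r i c| := by
    rw [← Finset.sum_add_distrib]
    refine Finset.sum_le_sum fun i _ => ?_
    rw [← Finset.sum_add_distrib]
    refine Finset.sum_le_sum fun c _ => ?_
    have h : -(z i c * (ρ i c - r i c)) ≤ |ρ i c - r i c| := by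
      refine (neg_le_abs _).trans ?_
      rw [abs_mul]
      exact mul_le_of_le_one_left (abs_nonneg _) (hz i c)
    linarith
  have h4 : ∑ i, y i * |ρ i (x i) - r i (x i)| + ∑ i, ∑ c, |ρ i c - r i c| ≤ e := by
    refine le_trans ?_ he
    rw [← Finset.sum_add_distrib]
    refine Finset.sum_le_sum fun i _ => ?_
    have h : |ρ i (x i) - r i (x i)| ≤ ∑ c, |ρ i c - r i c| :=
      Finset.single_le_sum (f := fun c => |ρ i c - r i c|) (fun c _ => abs_nonneg _)
        (Finset.mem_univ _)
    rw [← Finset.mul_sum, add_mul, one_mul]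
    have := mul_le_mul_of_nonneg_left h (hy i)
    linarith
  have h5 : ∑ i, m i * (y i - 1) = ∑ i, y i * m i - ∑ i, m i := by
    rw [← Finset.sum_sub_distrib]
    exact Finset.sum_congr rfl fun i _ => by ring
  rw [labelForm_scaled_left]
  linarith

/-- Lower bound for the score of a fixed labelling `x` in the sample. -/
theorem le_labelForm_scaled {η : V → V → ℝ} (hη : ∀ i j, η i j = η j i) {y : V → ℝ}
    (hy : ∀ i, 0 ≤ y i) (ρ : V → Fin q → ℝ) (x : V → Fin q) {e : ℝ}
    (he : ∑ i, ∑ c, (1 + y i) *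
      |ρ i c - labelAct η (fun j c => y j * oneHot x j c) i c| ≤ e) :
    labelForm η (oneHot x) (oneHot x) + ∑ i, ρ i (x i) * (y i - 1) +
        ∑ i, labelAct η (oneHot x) i (x i) * (y i - 1) - e ≤
      labelForm η (fun i c => y i * oneHot x i c) (fun i c => y i * oneHot x i c) := by
  set r := labelAct η (fun j c => y j * oneHot x j c) with hr
  have h1 : ∑ i, y i * labelAct η (oneHot x) i (x i) = ∑ i, r i (x i) := by
    rw [← labelForm_scaled_left, labelForm_comm hη, labelForm_oneHot_left]
  have h2 : ∑ i, ρ i (x i) * (y i - 1) - ∑ i, r i (x i) * (y i - 1) ≤ e := by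
    refine le_trans ?_ he
    rw [← Finset.sum_sub_distrib]
    refine Finset.sum_le_sum fun i _ => ?_
    have h : |ρ i (x i) - r i (x i)| ≤ ∑ c, |ρ i c - r i c| :=
      Finset.single_le_sum (f := fun c => |ρ i c - r i c|) (fun c _ => abs_nonneg _)
        (Finset.mem_univ _)
    rw [← Finset.mul_sum]
    have hy' : |y i - 1| ≤ 1 + y i := by
      have := hy i
      rw [abs_le]; constructor <;> linarith
    calc ρ i (x i) * (y i - 1) - r i (x i) * (y i - 1) = (ρ i (x i) - r i (x i)) * (y i - 1) := by
          ring
      _ ≤ |ρ i (x i) - r i (x i)| * |y i - 1| := by rw [← abs_mul]; exact le_abs_self _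
      _ ≤ (∑ c, |ρ i c - r i c|) * (1 + y i) := by gcongr
      _ = _ := mul_comm _ _
  have h3 : labelForm η (oneHot x) (oneHot x) = ∑ i, labelAct η (oneHot x) i (x i) :=
    labelForm_oneHot_left _ _ _
  have h4 : ∑ i, labelAct η (oneHot x) i (x i) * (y i - 1) =
      ∑ i, y i * labelAct η (oneHot x) i (x i) - ∑ i, labelAct η (oneHot x) i (x i) := by
    rw [← Finset.sum_sub_distrib]
    exact Finset.sum_congr rfl fun i _ => by ring
  have h5 : ∑ i, r i (x i) * (y i - 1) = ∑ i, y i * r i (x i) - ∑ i, r i (x i) := by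
    rw [← Finset.sum_sub_distrib]
    exact Finset.sum_congr rfl fun i _ => by ring
  rw [labelForm_scaled_left]
  linarith

/-- A weighted graph on `n` vertices with edge weights `ω ≤ 1`, of average degree about `Δ`, and
sampling probabilities `p` proportional to the truncated degrees `g` up to a cap at `1`: the
rescaling factors `1 / p i` are at most `β / g i` where they are not trivial. -/
structure IsSampling (ω : V → V → ℝ) (g p : V → ℝ) (n Δ ε β : ℝ) : Prop where
  card_eq : n = Fintype.card V
  three_le : 3 ≤ n
  pos : 0 < Δ
  le_card : Δ ≤ n
  eps_pos : 0 < ε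
  eps_le : ε ≤ 1
  beta_pos : 0 < β
  symm : ∀ i j, ω i j = ω j i
  weight_nonneg : ∀ i j, 0 ≤ ω i j
  weight_le : ∀ i j, ω i j ≤ 1
  degree_le : ∀ i, ∑ j, ω i j ≤ g i
  floor_le : ∀ i, ε * Δ ≤ g i
  sum_le : ∑ i, g i ≤ 2 * n * Δ
  prob_pos : ∀ i, 0 < p i
  prob_le : ∀ i, p i ≤ 1
  prob_ge : ∀ i, p i = 1 ∨ g i ≤ β * p i

namespace IsSampling

variable {ω : V → V → ℝ} {g p : V → ℝ} {n Δ ε β : ℝ}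

theorem prob_mem (h : IsSampling ω g p n Δ ε β) :
    ∀ i ∈ (Finset.univ : Finset V), 0 ≤ p i ∧ p i ≤ 1 :=
  fun i _ => ⟨(h.prob_pos i).le, h.prob_le i⟩

theorem g_pos (h : IsSampling ω g p n Δ ε β) (i : V) : 0 < g i :=
  (mul_pos h.eps_pos h.pos).trans_le (h.floor_le i)

/-- Concentration of linear functions with coefficients `O(g i)`. -/
theorem linear_tail (h : IsSampling ω g p n Δ ε β) {M τ : ℝ} (hM : 0 < M) (hτ : 0 < τ)
    (hτ4 : τ ≤ 4) {c : V → ℝ} (hc : ∀ i, |c i| ≤ M * g i) :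
    bernoulliProb Finset.univ p
      (fun S => τ * M * (n * Δ) ≤ ∑ i, c i * (inverseWeight p S i - 1)) ≤
        Real.exp (-(τ ^ 2 * (n * Δ) / (8 * β))) := by
  have hβ := h.beta_pos
  set l : ℝ := τ / (4 * M * β) with hl
  have hlpos : 0 < l := by positivity
  have key := bernoulliProb_centred_le h.prob_mem (K := 1) (r := 1) zero_le_one
    (fun u hu => exp_le_one_add_add_sq hu) (c := fun i => l * c i)
    (v := fun i => τ ^ 2 / (16 * β) * g i)
    (fun i _ => by have := h.g_pos i; positivity) (fun i _ => by
      rcases h.prob_ge i with h1 | h1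
      · exact Or.inl h1
      · right
        have hgi := h.g_pos i
        have hpi := h.prob_pos i
        have h2 : |l * c i| ≤ τ / (4 * β) * g i := by
          rw [abs_mul, abs_of_pos hlpos]
          calc l * |c i| ≤ l * (M * g i) := by gcongr; exact hc i
            _ = _ := by rw [hl]; field_simp
        constructor
        · refine h2.trans ?_
          rw [div_mul_eq_mul_div, div_le_iff₀ (by positivity)]
          nlinarith
        · calc (l * c i) ^ 2 = |l * c i| ^ 2 := (sq_abs _).symm
            _ ≤ (τ / (4 * β) * g i) ^ 2 := by gcongr
            _ = g i * (τ ^ 2 / (16 * β ^ 2) * g i) := by field_simp; ring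
            _ ≤ (β * p i) * (τ ^ 2 / (16 * β ^ 2) * g i) := by gcongr
            _ = _ := by field_simp)
    (l * (τ * M * (n * Δ)))
  refine le_trans (bernoulliProb_mono h.prob_mem fun S _ hS => ?_) (key.trans ?_)
  · have : ∑ i, l * c i * (inverseWeight p S i - 1) =
        l * ∑ i, c i * (inverseWeight p S i - 1) := by
      rw [Finset.mul_sum]; exact Finset.sum_congr rfl fun i _ => by ring
    rw [this]
    gcongr
  · rw [Real.exp_le_exp, ← Finset.mul_sum]
    have h3 : τ ^ 2 / (16 * β) * ∑ i, g i ≤ τ ^ 2 / (16 * β) * (2 * n * Δ) := by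
      have := h.sum_le
      gcongr
    have h4 : l * (τ * M * (n * Δ)) = τ ^ 2 * (n * Δ) / (4 * β) := by rw [hl]; field_simp
    have h5 : τ ^ 2 / (16 * β) * (2 * n * Δ) = τ ^ 2 * (n * Δ) / (8 * β) := by
      field_simp; ring
    have h6 : τ ^ 2 * (n * Δ) / (4 * β) = 2 * (τ ^ 2 * (n * Δ) / (8 * β)) := by
      field_simp; ring
    linarith

/-- Concentration of linear functions with coefficients in `[0, 1]`, on the scale of the expected
value. -/
theorem unit_tail (h : IsSampling ω g p n Δ ε β) {t : ℝ} (ht : 0 < t)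
    {c : V → ℝ} (hc : ∀ i, 0 ≤ c i ∧ c i ≤ 1) (hsum : ∑ i, c i ≤ t) :
    bernoulliProb Finset.univ p
      (fun S => t ≤ ∑ i, c i * (inverseWeight p S i - 1)) ≤
        Real.exp (-(ε * Δ * t / (4 * β))) := by
  have hβ := h.beta_pos
  have hε := h.eps_pos
  have hΔ := h.pos
  set l : ℝ := ε * Δ / (2 * β) with hl
  have hlpos : 0 < l := by positivity
  have key := bernoulliProb_centred_le h.prob_mem (K := 1) (r := 1) zero_le_one
    (fun u hu => exp_le_one_add_add_sq hu) (c := fun i => l * c i)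
    (v := fun i => ε * Δ / (4 * β) * c i)
    (fun i _ => by have := (hc i).1; positivity) (fun i _ => by
      rcases h.prob_ge i with h1 | h1
      · exact Or.inl h1
      · right
        have hci := hc i
        have hpi := h.prob_pos i
        have h2 : ε * Δ ≤ β * p i := (h.floor_le i).trans h1
        have h3 : l ≤ p i / 2 := by
          rw [hl, div_le_iff₀ (by positivity)]; linarith
        constructor
        · rw [abs_of_nonneg (mul_nonneg hlpos.le hci.1)]
          nlinarith
        · calc (l * c i) ^ 2 = l * (l * c i) * c i := by ring
            _ ≤ (p i / 2) * (l * c i) * 1 := by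
              have := hci.1
              gcongr
              exact hci.2
            _ = _ := by rw [hl]; field_simp; ring)
    (l * t)
  refine le_trans (bernoulliProb_mono h.prob_mem fun S _ hS => ?_) (key.trans ?_)
  · have : ∑ i, l * c i * (inverseWeight p S i - 1) =
        l * ∑ i, c i * (inverseWeight p S i - 1) := by
      rw [Finset.mul_sum]; exact Finset.sum_congr rfl fun i _ => by ring
    rw [this]
    gcongr
  · rw [Real.exp_le_exp, ← Finset.mul_sum]
    have h3 : ε * Δ / (4 * β) * ∑ i, c i ≤ ε * Δ / (4 * β) * t := by gcongr
    have h4 : l * t = 2 * (ε * Δ * t / (4 * β)) := by rw [hl]; field_simp; norm_num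
    have h5 : ε * Δ / (4 * β) * t = ε * Δ * t / (4 * β) := by ring
    linarith

end IsSampling

/-- The number of seed sequences is outweighed by the exponential tail of a linear function. -/
theorem card_seeds_mul_exp_le {k q : ℕ} {n Δ θ β L : ℝ} {N : ℕ} (hN : n = N) (hn : 3 ≤ n)
    (hL : L = Real.log n) (hΔ : 0 < Δ) (hΔn : Δ ≤ n) (hq : 1 ≤ q) (hθ : 0 < θ) (hθ1 : θ ≤ 1)
    (hβ0 : 0 < β) (hβ : 10 ^ 6 * (q : ℝ) ^ 2 * L * β ≤ Δ ^ 2 * θ ^ 4)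
    (hk : (k : ℝ) ≤ 648 * q * n / (Δ * θ ^ 2) + 1) :
    (((N * q + 1) ^ k : ℕ) : ℝ) * Real.exp (-((θ / 9) ^ 2 * (n * Δ) / (8 * β))) ≤
      Real.exp (-(5 * L)) := by
  have hn0 : 0 < n := by linarith
  have hLpos : 0 < L := hL ▸ Real.log_pos (by linarith)
  have hq' : (1 : ℝ) ≤ q := by exact_mod_cast hq
  have hexp : Real.exp L = n := by rw [hL, Real.exp_log hn0]
  have h1 : ((N * q + 1 : ℕ) : ℝ) ≤ Real.exp ((q + 1 : ℕ) * L) := by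
    rw [Real.exp_nat_mul, hexp, pow_succ, hN]
    have hN1 : 3 ≤ N := by exact_mod_cast hN ▸ hn
    have h2 : q + 1 ≤ N ^ q := by
      calc q + 1 ≤ 2 ^ q := Nat.lt_two_pow_self
        _ ≤ N ^ q := Nat.pow_le_pow_left (by omega) q
    have h3 : N * q + 1 ≤ N ^ q * N := by nlinarith
    exact_mod_cast h3
  set Q : ℝ := q ^ 2 * n / (Δ * θ ^ 2) with hQ
  have hden : Δ * θ ^ 2 ≤ n := by nlinarith [pow_le_one₀ hθ.le hθ1 (n := 2)]
  have hQ1 : 1 ≤ Q := by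
    rw [hQ, le_div_iff₀ (by positivity)]
    have : (1 : ℝ) ≤ (q : ℝ) ^ 2 := one_le_pow₀ hq'
    nlinarith
  have hk' : (k : ℝ) * (q + 1) ≤ 1298 * Q := by
    have ha : 1 ≤ q * n / (Δ * θ ^ 2) := by
      rw [le_div_iff₀ (by positivity)]
      nlinarith
    have hb : (k : ℝ) ≤ 649 * (q * n / (Δ * θ ^ 2)) := by
      refine hk.trans ?_
      have : 648 * q * n / (Δ * θ ^ 2) = 648 * (q * n / (Δ * θ ^ 2)) := by ring
      linarith
    calc (k : ℝ) * (q + 1) ≤ 649 * (q * n / (Δ * θ ^ 2)) * (2 * q) := by gcongr; linarith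
      _ = 1298 * Q := by rw [hQ]; ring
  have h4 : 1303 * Q * L ≤ (θ / 9) ^ 2 * (n * Δ) / (8 * β) := by
    rw [le_div_iff₀ (by positivity)]
    have : 1303 * Q * L * (8 * β) = 10424 / 10 ^ 6 * (10 ^ 6 * (q : ℝ) ^ 2 * L * β) *
        (n / (Δ * θ ^ 2)) := by rw [hQ]; ring
    rw [this]
    calc _ ≤ 10424 / 10 ^ 6 * (Δ ^ 2 * θ ^ 4) * (n / (Δ * θ ^ 2)) := by gcongr
      _ = 10424 / 10 ^ 6 * (n * Δ * θ ^ 2) := by field_simp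
      _ ≤ _ := by
        have : 0 < n * Δ * θ ^ 2 := by positivity
        nlinarith
  calc (((N * q + 1) ^ k : ℕ) : ℝ) * Real.exp (-((θ / 9) ^ 2 * (n * Δ) / (8 * β)))
      ≤ (Real.exp ((q + 1 : ℕ) * L)) ^ k * Real.exp (-(1303 * Q * L)) := by
        rw [Nat.cast_pow]; gcongr
    _ = Real.exp (k * (q + 1) * L - 1303 * Q * L) := by
        rw [← Real.exp_nat_mul, ← Real.exp_add]; push_cast; ring_nf
    _ ≤ _ := by
        rw [Real.exp_le_exp]
        have := mul_le_mul_of_nonneg_right hk' hLpos.le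
        nlinarith

namespace IsSampling

variable {ω : V → V → ℝ} {g p : V → ℝ} {n Δ ε β : ℝ}

set_option maxHeartbeats 1000000 in
/-- The maximum of a labelling problem with `q` labels is preserved by vertex sampling, up to an
error of `θ * n * Δ`. -/
theorem prob_maxLabelForm (h : IsSampling ω g p n Δ ε β) [NeZero q] {η : V → V → ℝ}
    (hηs : ∀ i j, η i j = η j i) (hdiag : ∀ i, η i i = 0) (hη : ∀ i j, |η i j| ≤ ω i j)
    {θ : ℝ} (hθ : 0 < θ) (hθε : θ ≤ ε)
    (hβ : 10 ^ 6 * (q : ℝ) ^ 2 * Real.log n * β ≤ Δ ^ 2 * θ ^ 4) :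
    bernoulliProb Finset.univ p (fun S => ¬ |maxLabelForm q η (inverseWeight p S) -
      maxLabelForm q η 1| ≤ θ * n * Δ) ≤ 1 / n ^ 3 := by
  classical
  set L := Real.log n with hL
  have hn := h.three_le
  have hn0 : 0 < n := by linarith
  have hΔ := h.pos
  have hΔn := h.le_card
  have hε := h.eps_pos
  have hε1 := h.eps_le
  have hβ0 := h.beta_pos
  have hLpos : 0 < L := Real.log_pos (by linarith)
  have hq : 1 ≤ q := NeZero.one_le
  have hq' : (1 : ℝ) ≤ q := by exact_mod_cast hq
  have hβ' : 10 ^ 6 * L * β ≤ Δ ^ 2 * ε ^ 2 := by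
    have h1 : θ ^ 4 ≤ ε ^ 2 := by
      calc θ ^ 4 ≤ ε ^ 4 := by gcongr
        _ ≤ ε ^ 2 := pow_le_pow_of_le_one hε.le hε1 (by norm_num)
    have h2 : 10 ^ 6 * L * β ≤ 10 ^ 6 * (q : ℝ) ^ 2 * L * β := by
      have : (1 : ℝ) ≤ (q : ℝ) ^ 2 := one_le_pow₀ hq'
      have : 0 < L * β := by positivity
      nlinarith
    have h3 : Δ ^ 2 * θ ^ 4 ≤ Δ ^ 2 * ε ^ 2 := by gcongr
    linarith
  have hΔ2 : Δ ^ 2 ≤ n * Δ := by nlinarith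
  set k : ℕ := ⌈648 * q * n / (Δ * θ ^ 2)⌉₊ with hk
  have hkpos : 0 < k := Nat.ceil_pos.2 (by positivity)
  have hk1 : 72 * q * n ≤ k * Δ * (θ / 3) ^ 2 := by
    have := Nat.le_ceil (648 * q * n / (Δ * θ ^ 2))
    rw [div_le_iff₀ (by positivity)] at this
    rw [← hk] at this
    nlinarith
  have hk2 : (k : ℝ) ≤ 648 * q * n / (Δ * θ ^ 2) + 1 := (Nat.ceil_lt_add_one (by positivity)).le
  let ρ : (Fin k → Option (V × Fin q)) → V → Fin q → ℝ := fun R =>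
    seedEstimate η g (4 * n * Δ) R
  choose z hz1 hz2 using fun R => exists_dual_certificate hηs hdiag (ρ R)
  let m : (Fin k → Option (V × Fin q)) → V → ℝ := fun R i =>
    ⨆ c, (ρ R i c - labelAct η (z R) i c)
  have hρ : ∀ R i c, |ρ R i c| ≤ 2 * g i := fun R i c =>
    abs_seedEstimate_le η h.g_pos _ R i c
  have hact : ∀ (Z : V → Fin q → ℝ), (∀ i c, |Z i c| ≤ 1) → ∀ i c, |labelAct η Z i c| ≤ g i :=
    fun Z hZ i c => by
      refine (Finset.abs_sum_le_sum_abs _ _).trans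
        ((Finset.sum_le_sum fun j _ => ?_).trans (h.degree_le i))
      rw [abs_mul]
      have := hη i j; have := hZ j c; have := abs_nonneg (η i j)
      nlinarith
  have hm : ∀ R i c, ρ R i c - labelAct η (z R) i c ≤ m R i := fun R i c =>
    le_ciSup (f := fun c => ρ R i c - labelAct η (z R) i c) (Set.finite_range _).bddAbove c
  have hm' : ∀ R i, ∃ c, ρ R i c - labelAct η (z R) i c = m R i := fun R i =>
    exists_eq_ciSup_of_finite (f := fun c => ρ R i c - labelAct η (z R) i c)
  have hm3 : ∀ R i, |m R i| ≤ 3 * g i := fun R i => by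
    obtain ⟨c, hc⟩ := hm' R i
    rw [← hc]
    have h1 := abs_sub (ρ R i c) (labelAct η (z R) i c)
    have h2 := hρ R i c
    have h3 := hact _ (hz1 R) i c
    linarith
  have hone : maxLabelForm q η 1 = ⨆ x : V → Fin q, labelForm η (oneHot x) (oneHot x) := by
    unfold maxLabelForm
    simp only [Pi.one_apply, one_mul]
  have hmv : ∀ R, ∑ i, m R i + ∑ i, ∑ c, z R i c * ρ R i c ≤ maxLabelForm q η 1 := fun R => by
    choose x hx using hm' R
    rw [hone]
    simpa only [hx] using hz2 R x
  obtain ⟨x₀, hx₀⟩ : ∃ x : V → Fin q, labelForm η (oneHot x) (oneHot x) = maxLabelForm q η 1 := by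
    rw [hone]; exact exists_eq_ciSup_of_finite
  have hx₀1 : ∀ i c, |oneHot x₀ i c| ≤ 1 := fun i c => by
    rw [abs_of_nonneg (oneHot_nonneg _ _ _)]; exact oneHot_le_one _ _ _
  -- the bad events: the total weight, the total degree, the sampled degree of a vertex, the linear
  -- function that belongs to a seed sequence, and the two linear functions of the lower bound
  have p1 := h.linear_tail (M := 1 / (ε * Δ)) (by positivity) hε (by linarith) (c := fun _ => 1)
    (fun i => by
      rw [abs_one, one_div, inv_mul_eq_div, one_le_div (by positivity)]; exact h.floor_le i)
  have p2 := h.linear_tail (M := 1) one_pos (τ := 2) two_pos (by norm_num) (c := g)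
    (fun i => by rw [one_mul, abs_of_pos (h.g_pos i)])
  have p3 : ∀ j ∈ (Finset.univ : Finset V), _ := fun j _ => h.unit_tail (h.g_pos j)
    (c := fun i => ω i j) (fun i => ⟨h.weight_nonneg i j, h.weight_le i j⟩) (by
      simp only [h.symm _ j]; exact h.degree_le j)
  have p4 : ∀ R ∈ (Finset.univ : Finset (Fin k → Option (V × Fin q))), _ := fun R _ =>
    h.linear_tail (M := 3) (by norm_num) (τ := θ / 9) (by positivity) (by linarith) (hm3 R)
  have p5 : ∀ R ∈ (Finset.univ : Finset (Fin k → Option (V × Fin q))), _ := fun R _ =>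
    h.linear_tail (M := 3) (by norm_num) (τ := θ / 9) (by positivity) (by linarith)
      (c := fun i => -ρ R i (x₀ i)) (fun i => by
        rw [abs_neg]; have := hρ R i (x₀ i); have := h.g_pos i; linarith)
  have p6 := h.linear_tail (M := 3) (by norm_num) (τ := θ / 9) (by positivity) (by linarith)
      (c := fun i => -labelAct η (oneHot x₀) i (x₀ i)) (fun i => by
        rw [abs_neg]; have := hact _ hx₀1 i (x₀ i); have := h.g_pos i; linarith)
  have hseed := card_seeds_mul_exp_le h.card_eq hn hL hΔ hΔn hq hθ (hθε.trans hε1) hβ0 hβ hk2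
  have hcard : Fintype.card (Fin k → Option (V × Fin q)) = (Fintype.card V * q + 1) ^ k := by
    simp
  have e1 : Real.exp (-(ε ^ 2 * (n * Δ) / (8 * β))) ≤ Real.exp (-(5 * L)) := by
    rw [Real.exp_le_exp, neg_le_neg_iff, le_div_iff₀ (by positivity)]
    have : 0 < L * β := by positivity
    have : Δ ^ 2 * ε ^ 2 ≤ ε ^ 2 * (n * Δ) := by nlinarith [sq_nonneg ε]
    linarith
  have e2 : Real.exp (-((2 : ℝ) ^ 2 * (n * Δ) / (8 * β))) ≤ Real.exp (-(5 * L)) := by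
    refine le_trans ?_ e1
    rw [Real.exp_le_exp, neg_le_neg_iff]
    gcongr
    linarith
  have e3 : ∀ j ∈ (Finset.univ : Finset V), Real.exp (-(ε * Δ * g j / (4 * β))) ≤
      Real.exp (-(5 * L)) := fun j _ => by
    rw [Real.exp_le_exp, neg_le_neg_iff, le_div_iff₀ (by positivity)]
    have : 0 < L * β := by positivity
    have : ε * Δ * (ε * Δ) ≤ ε * Δ * g j := by
      have := h.floor_le j
      gcongr
    nlinarith
  have e6 : Real.exp (-((θ / 9) ^ 2 * (n * Δ) / (8 * β))) ≤ Real.exp (-(5 * L)) := by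
    refine le_trans (le_mul_of_one_le_left (Real.exp_pos _).le ?_) hseed
    exact_mod_cast Nat.one_le_pow _ _ (by omega)
  have p3' := (bernoulliProb_exists_le h.prob_mem Finset.univ _).trans
    (Finset.sum_le_card_nsmul _ _ _ fun j hj => (p3 j hj).trans (e3 j hj))
  have p4' := (bernoulliProb_exists_le h.prob_mem Finset.univ _).trans
    (Finset.sum_le_card_nsmul _ _ _ p4)
  have p5' := (bernoulliProb_exists_le h.prob_mem Finset.univ _).trans
    (Finset.sum_le_card_nsmul _ _ _ p5)
  rw [Finset.card_univ, nsmul_eq_mul] at p3' p4' p5'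
  rw [hcard] at p4' p5'
  have hor := (bernoulliProb_or_le h.prob_mem _ _).trans (add_le_add (p1.trans e1)
    ((bernoulliProb_or_le h.prob_mem _ _).trans (add_le_add (p2.trans e2)
    ((bernoulliProb_or_le h.prob_mem _ _).trans (add_le_add p3'
    ((bernoulliProb_or_le h.prob_mem _ _).trans (add_le_add (p4'.trans hseed)
    ((bernoulliProb_or_le h.prob_mem _ _).trans (add_le_add (p5'.trans hseed)
      (p6.trans e6))))))))))
  rw [← h.card_eq] at hor
  refine le_trans (bernoulliProb_mono h.prob_mem fun S _ => ?_) (hor.trans ?_)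
  · contrapose!
    rintro ⟨g1, g2, g3, g4, g5, g6⟩
    have hy : ∀ i, 0 ≤ inverseWeight p S i := fun i => by
      unfold inverseWeight
      have := h.prob_pos i
      split_ifs <;> positivity
    generalize inverseWeight p S = y at *
    have hy1 : ∑ i, y i ≤ 2 * n := by
      simp only [one_mul, Finset.sum_sub_distrib, Finset.sum_const, Finset.card_univ,
        nsmul_eq_mul, mul_one, ← h.card_eq] at g1
      have : ε * (1 / (ε * Δ)) * (n * Δ) = n := by field_simp
      linarith
    have hy2 : ∑ i, y i * g i ≤ 4 * n * Δ := by
      have h1 : ∑ i, g i * (y i - 1) = ∑ i, y i * g i - ∑ i, g i := by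
        rw [← Finset.sum_sub_distrib]; exact Finset.sum_congr rfl fun i _ => by ring
      have := h.sum_le
      linarith
    have hy3 : ∀ j, ∑ i, ω i j * y i ≤ 2 * g j := fun j => by
      have h1 : ∑ i, ω i j * (y i - 1) = ∑ i, ω i j * y i - ∑ i, ω i j := by
        rw [← Finset.sum_sub_distrib]; exact Finset.sum_congr rfl fun i _ => by ring
      have h2 := g3 j (Finset.mem_univ j)
      have h3 := h.degree_le j
      simp only [h.symm j] at h3
      linarith
    have hnet := exists_seedEstimate_near h.card_eq hn0 hΔ (κ := θ / 3) (by positivity)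
      h.weight_le hη h.symm h.g_pos (fun j => by simp only [h.symm _ j]; exact h.degree_le j)
      hy hy1 hy2 hy3 hk1 hkpos
    have herr : θ / 9 * 3 * (n * Δ) = θ / 3 * n * Δ := by ring
    rw [herr] at g4 g5 g6
    have hpos : 0 < θ / 3 * n * Δ := by positivity
    rw [abs_le]
    constructor
    · obtain ⟨R, hR⟩ := hnet x₀
      have h1 := le_labelForm_scaled hηs hy (ρ R) x₀ hR
      have h2 := g5 R (Finset.mem_univ R)
      simp only [neg_mul, Finset.sum_neg_distrib] at h2 g6
      have h3 : labelForm η (fun i c => y i * oneHot x₀ i c) (fun i c => y i * oneHot x₀ i c) ≤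
          maxLabelForm q η y :=
        le_ciSup (f := fun x : V → Fin q => labelForm η (fun i c => y i * oneHot x i c)
          (fun i c => y i * oneHot x i c)) (Set.finite_range _).bddAbove x₀
      rw [hx₀] at h1
      linarith
    · have h3 : maxLabelForm q η y ≤ maxLabelForm q η 1 + θ * n * Δ := by
        refine ciSup_le fun x => ?_
        obtain ⟨R, hR⟩ := hnet x
        have h1 := labelForm_scaled_le hηs hy (hz1 R) (hm R) (hmv R) x hR
        have h2 := g4 R (Finset.mem_univ R)
        linarith
      linarith
  · have hexp : Real.exp (-(5 * L)) = 1 / n ^ 5 := by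
      rw [Real.exp_neg, one_div]
      congr 1
      have : (5 : ℝ) * L = (5 : ℕ) * L := by norm_num
      rw [this, Real.exp_nat_mul, hL, Real.exp_log hn0]
    rw [hexp]
    have h1 : 1 / n ^ 3 = n ^ 2 * (1 / n ^ 5) := by field_simp
    have h2 : 0 < 1 / n ^ 5 := by positivity
    have h3 : n + 5 ≤ n ^ 2 := by nlinarith
    rw [h1]
    linarith [mul_le_mul_of_nonneg_right h3 h2.le]

end IsSampling

end VertexSampling

/-! ### The two stages combined -/

section TwoStage

variable {V Λ : Type*} [Fintype V]

/-- If the set of vertices is good except with probability `a`, and the event holds for each good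
set of vertices except with probability `b`, then the failure probability is at most `a + b`. -/
theorem twoStageProb_ge {E : Finset (Sym2 V)} {p : V → ℝ} {pe : Finset V → Sym2 V → ℝ}
    {event : Finset V → Finset (Sym2 V) → Prop} {good : Finset V → Prop} {a b : ℝ}
    (hp : ∀ i ∈ (Finset.univ : Finset V), 0 ≤ p i ∧ p i ≤ 1)
    (hpe : ∀ S, ∀ e ∈ edgesWithin E S, 0 ≤ pe S e ∧ pe S e ≤ 1) (hb : 0 ≤ b)
    (ha : bernoulliProb Finset.univ p (fun S => ¬ good S) ≤ a)
    (hgood : ∀ S, good S → bernoulliProb (edgesWithin E S) (pe S) (fun F => ¬ event S F) ≤ b) :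
    1 - (a + b) ≤ twoStageProb E p pe event := by
  classical
  change _ ≤ bernoulliExp Finset.univ p fun S =>
    bernoulliProb (edgesWithin E S) (pe S) (event S)
  have h1 : bernoulliExp Finset.univ p (fun S => 1 + ((-1) * (if ¬ good S then 1 else 0) + -b)) ≤
      bernoulliExp Finset.univ p fun S => bernoulliProb (edgesWithin E S) (pe S) (event S) := by
    refine bernoulliExp_mono hp fun S _ => ?_
    by_cases hS : good S
    · have h2 := hgood S hS
      rw [bernoulliProb_not] at h2
      simp only [hS, not_true_eq_false, if_false]
      linarith
    · have h2 := bernoulliProb_nonneg (hpe S) (event S)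
      simp only [hS, not_false_eq_true, if_true]
      linarith
  refine le_trans ?_ h1
  have h2 : ∀ f g : Finset V → ℝ, bernoulliExp Finset.univ p (fun S => f S + g S) =
      bernoulliExp Finset.univ p f + bernoulliExp Finset.univ p g := fun f g => by
    unfold bernoulliExp
    rw [← Finset.sum_add_distrib]
    exact Finset.sum_congr rfl fun S _ => by ring
  rw [h2, h2, bernoulliExp_const, bernoulliExp_const, bernoulliExp_mul_left]
  have : bernoulliProb Finset.univ p (fun S => ¬ good S) =
    bernoulliExp Finset.univ p (fun S => if ¬ good S then 1 else 0) := by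
    unfold bernoulliProb
    congr!
  rw [← this]
  linarith

open scoped Classical in
/-- The symmetric matrix of a function on the edges. -/
noncomputable def edgeMatrix (E : Finset (Sym2 V)) (φ : Sym2 V → ℝ) (i j : V) : ℝ :=
  if s(i, j) ∈ E then φ s(i, j) else 0

omit [Fintype V] in
theorem edgeMatrix_comm (E : Finset (Sym2 V)) (φ : Sym2 V → ℝ) (i j : V) :
    edgeMatrix E φ i j = edgeMatrix E φ j i := by
  unfold edgeMatrix
  rw [Sym2.eq_swap]

open scoped Classical in
theorem sum_edgeMatrix (E : Finset (Sym2 V)) (φ : Sym2 V → ℝ) (i : V) :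
    ∑ j, edgeMatrix E φ i j = ∑ e ∈ E.filter (fun e => i ∈ e), φ e := by
  unfold edgeMatrix
  rw [← Finset.sum_filter]
  have : E.filter (fun e => i ∈ e) =
      (Finset.univ.filter fun j => s(i, j) ∈ E).image fun j => s(i, j) := by
    ext e
    simp only [Finset.mem_filter, Finset.mem_image, Finset.mem_univ, true_and]
    constructor
    · rintro ⟨he, hi⟩
      obtain ⟨j, rfl⟩ := hi
      exact ⟨j, he, rfl⟩
    · rintro ⟨j, hj, rfl⟩
      exact ⟨hj, Sym2.mem_mk_left i j⟩
  rw [this, Finset.sum_image]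
  exact fun j _ k _ h => Sym2.congr_right.1 h

theorem labelForm_scaled_eq {q : ℕ} (η : V → V → ℝ) (y : V → ℝ) (x : V → Fin q) :
    labelForm η (fun i c => y i * oneHot x i c) (fun i c => y i * oneHot x i c) =
      ∑ i, ∑ j, η i j * (y i * y j) * (if x i = x j then 1 else 0) := by
  rw [labelForm_scaled_left]
  refine Finset.sum_congr rfl fun i _ => ?_
  unfold labelAct
  rw [Finset.mul_sum]
  refine Finset.sum_congr rfl fun j _ => ?_
  simp only [oneHot, eq_comm]
  ring

/-- The maximum score as a sum of two maxima of quadratic forms, the first of which, with one label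
only, is the total negative weight. -/
theorem two_mul_maxLabelScore {q : ℕ} [NeZero q] {E : Finset (Sym2 V)}
    (hE : ∀ e ∈ E, ¬ e.IsDiag) {cp cm : Sym2 V → ℝ} {P M : V → V → ℝ} {y : V → ℝ}
    (hP : ∀ i j, edgeMatrix E cp i j = P i j * (y i * y j))
    (hM : ∀ i j, edgeMatrix E cm i j = M i j * (y i * y j)) :
    2 * maxLabelScore (Fin q) E cp cm =
      maxLabelForm 1 M y + maxLabelForm q (fun i j => P i j - M i j) y := by
  classical
  have hone : ∀ x : V → Fin 1, labelForm M (fun i c => y i * oneHot x i c)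
      (fun i c => y i * oneHot x i c) = ∑ i, ∑ j, M i j * (y i * y j) := fun x => by
    rw [labelForm_scaled_eq]
    refine Finset.sum_congr rfl fun i _ => Finset.sum_congr rfl fun j _ => ?_
    rw [if_pos (Subsingleton.elim _ _), mul_one]
  have h1 : maxLabelForm 1 M y = ∑ i, ∑ j, M i j * (y i * y j) := by
    unfold maxLabelForm
    simp only [hone, ciSup_const]
  have hscore : ∀ x : V → Fin q, 2 * labelScore E cp cm x = maxLabelForm 1 M y +
      labelForm (fun i j => P i j - M i j) (fun i c => y i * oneHot x i c)
        (fun i c => y i * oneHot x i c) := fun x => by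
    rw [h1, labelForm_scaled_eq, labelScore, ← sum_sum_ite_mem_edges hE,
      ← Finset.sum_add_distrib]
    refine Finset.sum_congr rfl fun i _ => ?_
    rw [← Finset.sum_add_distrib]
    refine Finset.sum_congr rfl fun j _ => ?_
    have h2 := hP i j
    have h3 := hM i j
    unfold edgeMatrix at h2 h3
    rw [sameLabel_mk, sub_mul, ← h2, ← h3]
    by_cases hij : s(i, j) ∈ E <;> by_cases hx : x i = x j <;> simp [hij, hx]
  refine le_antisymm ?_ ?_
  · obtain ⟨x, hx⟩ := exists_labelScore_eq_max (Λ := Fin q) E cp cm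
    rw [← hx, hscore]
    gcongr
    exact le_ciSup (f := fun x : V → Fin q => labelForm (fun i j => P i j - M i j)
      (fun i c => y i * oneHot x i c) (fun i c => y i * oneHot x i c))
      (Set.finite_range _).bddAbove x
  · obtain ⟨x, hx⟩ : ∃ x : V → Fin q, labelForm (fun i j => P i j - M i j)
        (fun i c => y i * oneHot x i c) (fun i c => y i * oneHot x i c) =
        maxLabelForm q (fun i j => P i j - M i j) y := exists_eq_ciSup_of_finite
    rw [← hx, ← hscore]
    linarith [labelScore_le_max E cp cm x]

omit [Fintype V] in
theorem maxLabelScore_const_mul [Finite V] [Finite Λ] [Nonempty Λ] (E : Finset (Sym2 V))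
    (cp cm : Sym2 V → ℝ) {a : ℝ} (ha : 0 ≤ a) :
    maxLabelScore Λ E (fun e => a * cp e) (fun e => a * cm e) = a * maxLabelScore Λ E cp cm := by
  unfold maxLabelScore
  rw [Real.mul_iSup_of_nonneg ha]
  congr 1
  funext x
  unfold labelScore
  rw [Finset.mul_sum]
  exact Finset.sum_congr rfl fun e _ => by ring

omit [Fintype V] in
theorem maxLabelScore_le_sum [Finite V] [Finite Λ] [Nonempty Λ] {E : Finset (Sym2 V)}
    {cp cm : Sym2 V → ℝ} (hp : ∀ e ∈ E, 0 ≤ cp e) (hm : ∀ e ∈ E, 0 ≤ cm e) :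
    maxLabelScore Λ E cp cm ≤ ∑ e ∈ E, (cp e + cm e) := by
  refine ciSup_le fun x => Finset.sum_le_sum fun e he => ?_
  have h1 := sameLabel_nonneg x e
  have h2 := sameLabel_le_one x e
  have h3 := hp e he
  have h4 := hm e he
  nlinarith

omit [Fintype V] in
theorem vertexScale_pos {p : V → ℝ} (hp : ∀ i, 0 < p i) {Δ : ℝ} (hΔ : 0 < Δ) (e : Sym2 V) :
    0 < vertexScale p Δ e := by
  induction e using Sym2.ind with
  | h i j =>
    have := hp i
    have := hp j
    simp only [vertexScale, Sym2.map_mk, Sym2.mul_mk]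
    positivity

omit [Fintype V] in
theorem mem_edgesWithin {E : Finset (Sym2 V)} {S : Finset V} {e : Sym2 V} :
    e ∈ edgesWithin E S ↔ e ∈ E ∧ ∀ v ∈ e, v ∈ S := by
  simp [edgesWithin]

omit [Fintype V] in
/-- The matrix of the sample, with the normalisation undone, arises from that of the whole graph
by rescaling rows and columns. -/
theorem edgeMatrix_vertexSample (E : Finset (Sym2 V)) (S : Finset V) (c : Sym2 V → ℝ) (p : V → ℝ)
    {Δ : ℝ} (hΔ : 0 < Δ) (i j : V) :
    edgeMatrix (edgesWithin E S) (fun e => Δ ^ 2 * (vertexScale p Δ e * c e)) i j =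
      edgeMatrix E c i j * (inverseWeight p S i * inverseWeight p S j) := by
  unfold edgeMatrix inverseWeight
  have hmem : s(i, j) ∈ edgesWithin E S ↔ s(i, j) ∈ E ∧ i ∈ S ∧ j ∈ S := by
    simp [mem_edgesWithin]
  by_cases h : s(i, j) ∈ edgesWithin E S
  · obtain ⟨h1, h2, h3⟩ := hmem.1 h
    simp only [h, h1, h2, h3, if_true, vertexScale, Sym2.map_mk, Sym2.mul_mk]
    field_simp
  · rw [hmem, not_and_or, not_and_or] at h
    rw [if_neg (by rw [hmem]; tauto)]
    rcases h with h | h | h <;> simp [h]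

namespace IsSampling

variable {ω : V → V → ℝ} {g p : V → ℝ} {n Δ ε β : ℝ}

/-- With the sampling probabilities at most twice the truncated importance scores, the number of
sampled vertices is `O(n * Δ / β)`. -/
theorem prob_card_le (h : IsSampling ω g p n Δ ε β) (hp : ∀ i, p i ≤ 2 * (g i / β)) :
    bernoulliProb Finset.univ p (fun S => 8 * (n * Δ) / β ≤ S.card) ≤
      Real.exp (-(n * Δ / (2 * β))) := by
  classical
  have hβ := h.beta_pos
  have key := h.linear_tail (M := 2 / β) (by positivity) (τ := 2) two_pos (by norm_num) (c := p)
    (fun i => by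
      rw [abs_of_pos (h.prob_pos i)]
      exact (hp i).trans (le_of_eq (by ring)))
  refine le_trans (bernoulliProb_mono h.prob_mem fun S _ hS => ?_) (key.trans (le_of_eq ?_))
  · have h1 : ∑ i, p i * (inverseWeight p S i - 1) = S.card - ∑ i, p i := by
      simp only [mul_sub, mul_one, Finset.sum_sub_distrib, inverseWeight]
      congr 1
      have : ∀ i, p i * (if i ∈ S then 1 / p i else 0) = if i ∈ S then 1 else 0 := fun i => by
        have := (h.prob_pos i).ne'
        split_ifs <;> field_simp; simp
      simp only [this]
      simp
    have h2 : ∑ i, p i ≤ 2 / β * (2 * n * Δ) := by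
      refine (Finset.sum_le_sum fun i _ => hp i).trans ?_
      have h3 : ∑ i, 2 * (g i / β) = 2 / β * ∑ i, g i := by
        rw [Finset.mul_sum]; exact Finset.sum_congr rfl fun i _ => by ring
      rw [h3]
      have := h.sum_le
      gcongr
    rw [h1]
    have h4 : 8 * (n * Δ) / β = 2 * (2 / β) * (n * Δ) + 2 / β * (2 * n * Δ) := by ring
    linarith
  · congr 2
    ring

/-- A lower bound for the number of sampled vertices. -/
theorem prob_le_card (h : IsSampling ω g p n Δ ε β) {t : ℝ} (ht : t ≤ n)
    (ht' : t ≤ n * (ε * Δ / β)) :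
    bernoulliProb Finset.univ p (fun S => (S.card : ℝ) ≤ t / 2) ≤ Real.exp (-(t / 16)) := by
  classical
  have hβ := h.beta_pos
  set f : V → ℝ := fun i => min 1 (g i / β) with hf
  have hf0 : ∀ i, 0 ≤ f i := fun i => by
    have := h.g_pos i
    exact le_min zero_le_one (by positivity)
  have hfp : ∀ i, f i ≤ p i := fun i => by
    rcases h.prob_ge i with h1 | h1
    · rw [h1]; exact min_le_left _ _
    · refine (min_le_right _ _).trans ?_
      rw [div_le_iff₀ hβ]; linarith
  have hsum : t ≤ ∑ i, f i := by
    have h1 : ∀ i, min 1 (ε * Δ / β) ≤ f i := fun i =>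
      min_le_min le_rfl (by have := h.floor_le i; gcongr)
    have h2 := Finset.card_nsmul_le_sum Finset.univ f _ fun i _ => h1 i
    rw [Finset.card_univ, nsmul_eq_mul, ← h.card_eq] at h2
    refine le_trans ?_ h2
    rcases min_cases 1 (ε * Δ / β) with ⟨h3, _⟩ | ⟨h3, _⟩ <;> rw [h3]
    · linarith
    · exact ht'
  have key := bernoulliProb_centred_le h.prob_mem (K := 1) (r := 1) zero_le_one
    (fun u hu => exp_le_one_add_add_sq hu) (c := fun i => -(f i / 4))
    (v := fun i => f i / 16) (fun i _ => by have := hf0 i; positivity) (fun i _ => by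
      right
      have h1 := hf0 i
      have h2 := hfp i
      constructor
      · rw [abs_neg, abs_of_nonneg (by positivity)]; linarith
      · nlinarith) ((∑ i, f i) / 8)
  refine le_trans (bernoulliProb_mono h.prob_mem fun S _ hS => ?_) (key.trans ?_)
  · have h1 : ∑ i, -(f i / 4) * (inverseWeight p S i - 1) =
        (∑ i, f i) / 4 - (∑ i, f i * inverseWeight p S i) / 4 := by
      rw [Finset.sum_div, Finset.sum_div, ← Finset.sum_sub_distrib]
      exact Finset.sum_congr rfl fun i _ => by ring
    have h2 : ∑ i, f i * inverseWeight p S i ≤ S.card := by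
      have : ∀ i, f i * inverseWeight p S i ≤ if i ∈ S then 1 else 0 := fun i => by
        unfold inverseWeight
        split_ifs
        · rw [mul_one_div, div_le_one (h.prob_pos i)]
          exact hfp i
        · simp
      refine (Finset.sum_le_sum fun i _ => this i).trans ?_
      simp
    rw [h1]
    linarith
  · rw [Real.exp_le_exp, ← Finset.sum_div]
    linarith

end IsSampling

/-- The elementary estimates by which the errors of the two stages combine to a factor `1 + ε`. -/
theorem withinFactor_of_stages {ε a b c : ℝ} (hε : 0 < ε) (hε1 : ε < 1) (hc : 0 ≤ c)
    (hb1 : (1 - 3 * ε / 1000) * c ≤ b) (hb2 : (1 - ε / 1000) * b ≤ (1 + ε / 500) * c)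
    (ha1 : (1 - ε / 50) * b ≤ a) (ha2 : a ≤ (1 + 97 / 100 * ε) * b) : WithinFactor ε a c := by
  constructor
  · rw [div_le_iff₀ (by linarith)]
    calc c ≤ ((1 - ε / 50) * (1 - 3 * ε / 1000) * (1 + ε)) * c := by
          refine le_mul_of_one_le_left hc ?_
          nlinarith [mul_pos hε hε, mul_pos (mul_pos hε hε) hε]
      _ = (1 - ε / 50) * ((1 - 3 * ε / 1000) * c) * (1 + ε) := by ring
      _ ≤ (1 - ε / 50) * b * (1 + ε) := by
          have : 0 ≤ 1 - ε / 50 := by linarith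
          gcongr
      _ ≤ a * (1 + ε) := by gcongr
  · refine ha2.trans (le_of_mul_le_mul_left ?_ (show 0 < 1 - ε / 1000 by linarith))
    calc (1 - ε / 1000) * ((1 + 97 / 100 * ε) * b) = (1 + 97 / 100 * ε) * ((1 - ε / 1000) * b) := by
          ring
      _ ≤ (1 + 97 / 100 * ε) * ((1 + ε / 500) * c) := by gcongr
      _ = ((1 + 97 / 100 * ε) * (1 + ε / 500)) * c := by ring
      _ ≤ ((1 - ε / 1000) * (1 + ε)) * c := by
          refine mul_le_mul_of_nonneg_right ?_ hc
          nlinarith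
      _ = _ := by ring

set_option maxHeartbeats 1000000 in
/-- The outcome of vertex sampling followed by edge sampling, for the maximum score of a labelling
with labels in `Λ`, when `q` labels are almost as good as those of `Λ`. -/
theorem twoStageProb_maxLabelScore [Fintype Λ] [Nonempty Λ] {q : ℕ} [NeZero q]
    {E : Finset (Sym2 V)} (hE : ∀ e ∈ E, ¬ e.IsDiag) {cp cm : Sym2 V → ℝ}
    (hcp : ∀ e ∈ E, 0 ≤ cp e) (hcm : ∀ e ∈ E, 0 ≤ cm e) (hcc : ∀ e ∈ E, cp e = 0 ∨ cm e = 0)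
    {g p : V → ℝ} {n Δ ε β : ℝ}
    (h : IsSampling (edgeMatrix E fun e => cp e + cm e) g p n Δ ε β) (hε1 : ε < 1)
    (hp : ∀ i, p i ≤ 2 * (g i / β)) (hΔ : n * Δ = 2 * ∑ e ∈ E, (cp e + cm e))
    (hn : 32000 * Real.log n ≤ n)
    (hβ : 10 ^ 6 * (q : ℝ) ^ 2 * Real.log n * β ≤ Δ ^ 2 * (ε / 2000) ^ 4)
    (hlab : ∀ (E' : Finset (Sym2 V)) (cp' cm' : Sym2 V → ℝ), (∀ e ∈ E', ¬ e.IsDiag) →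
      (∀ e ∈ E', 0 ≤ cp' e) → (∀ e ∈ E', 0 ≤ cm' e) →
      (1 - ε / 1000) * maxLabelScore Λ E' cp' cm' ≤ maxLabelScore (Fin q) E' cp' cm' ∧
      maxLabelScore (Fin q) E' cp' cm' ≤ maxLabelScore Λ E' cp' cm' ∧
      (∑ e ∈ E', (cp' e + cm' e)) / 2 ≤ maxLabelScore Λ E' cp' cm')
    {w pe : Finset V → Sym2 V → ℝ}
    (hw : ∀ S, ∀ e ∈ edgesWithin E S, w S e = vertexScale p Δ e * cp e + vertexScale p Δ e * cm e)
    (hpe : ∀ S e, pe S e =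
      min 1 (8 * S.card * w S e / (ε ^ 2 * ∑ e ∈ edgesWithin E S, w S e))) :
    1 - 1 / n ^ 2 ≤ twoStageProb E p pe fun S F =>
      WithinFactor ε (Δ ^ 2 * maxLabelScore Λ F (fun e => vertexScale p Δ e * cp e / pe S e)
        (fun e => vertexScale p Δ e * cm e / pe S e)) (maxLabelScore Λ E cp cm) ∧
      (S.card : ℝ) + F.card ≤ 200 * (n * Δ) / (β * ε ^ 2) := by
  classical
  have hn3 := h.three_le
  have hn0 : 0 < n := by linarith
  have hΔ0 := h.pos
  have hε := h.eps_pos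
  have hβ0 := h.beta_pos
  set L := Real.log n with hL
  have hL1 : 1 ≤ L := by
    rw [hL, Real.le_log_iff_exp_le hn0]
    linarith [Real.exp_one_lt_d9]
  have hq1 : (1 : ℝ) ≤ (q : ℝ) ^ 2 := one_le_pow₀ (by exact_mod_cast NeZero.one_le)
  have hβ1 : 10 ^ 6 * ((1 : ℕ) : ℝ) ^ 2 * L * β ≤ Δ ^ 2 * (ε / 2000) ^ 4 := by
    refine le_trans ?_ hβ
    have : 0 < L * β := by positivity
    push_cast
    nlinarith
  have hβε : 10 ^ 6 * L * β ≤ Δ ^ 2 * ε := by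
    have h1 : (ε / 2000) ^ 4 ≤ ε := by
      calc (ε / 2000) ^ 4 ≤ ε ^ 4 := by gcongr; linarith
        _ ≤ ε ^ 1 := pow_le_pow_of_le_one hε.le hε1.le (by norm_num)
        _ = ε := pow_one ε
    have h2 : Δ ^ 2 * (ε / 2000) ^ 4 ≤ Δ ^ 2 * ε := by gcongr
    push_cast at hβ1
    linarith
  have hvs : ∀ e, 0 < vertexScale p Δ e := vertexScale_pos h.prob_pos hΔ0
  have hmemE : ∀ {S e}, e ∈ edgesWithin E S → e ∈ E := fun he => (mem_edgesWithin.1 he).1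
  have hcp' : ∀ S, ∀ e ∈ edgesWithin E S, 0 ≤ vertexScale p Δ e * cp e := fun S e he =>
    mul_nonneg (hvs e).le (hcp e (hmemE he))
  have hcm' : ∀ S, ∀ e ∈ edgesWithin E S, 0 ≤ vertexScale p Δ e * cm e := fun S e he =>
    mul_nonneg (hvs e).le (hcm e (hmemE he))
  have hw0 : ∀ S, ∀ e ∈ edgesWithin E S, 0 ≤ w S e := fun S e he => by
    rw [hw S e he]; exact add_nonneg (hcp' S e he) (hcm' S e he)
  have hpe01 : ∀ S, ∀ e ∈ edgesWithin E S, 0 ≤ pe S e ∧ pe S e ≤ 1 := fun S e he => by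
    rw [hpe]
    have h1 := hw0 S e he
    have h2 : 0 ≤ ∑ e ∈ edgesWithin E S, w S e := Finset.sum_nonneg (hw0 S)
    exact ⟨le_min zero_le_one (by positivity), min_le_left _ _⟩
  -- the two forms whose maxima make up the maximum score
  set P := edgeMatrix E cp with hP
  set M := edgeMatrix E cm with hM
  have hdiag : ∀ (c : Sym2 V → ℝ) i, edgeMatrix E c i i = 0 := fun c i => by
    unfold edgeMatrix
    rw [if_neg]
    intro hi
    exact hE _ hi (by simp)
  have hMω : ∀ i j, |M i j| ≤ edgeMatrix E (fun e => cp e + cm e) i j := fun i j => by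
    simp only [hM, edgeMatrix]
    split_ifs with hij
    · rw [abs_of_nonneg (hcm _ hij)]; linarith [hcp _ hij]
    · simp
  have hPMω : ∀ i j, |P i j - M i j| ≤ edgeMatrix E (fun e => cp e + cm e) i j := fun i j => by
    simp only [hM, hP, edgeMatrix]
    split_ifs with hij
    · have := hcm _ hij
      have := hcp _ hij
      rw [abs_le]; constructor <;> linarith
    · simp
  have hθ : 0 < ε / 2000 := by positivity
  have c1 := h.prob_maxLabelForm (q := 1) (fun i j => edgeMatrix_comm E cm i j) (hdiag cm) hMω
    hθ (by linarith) hβ1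
  have c2 := h.prob_maxLabelForm (q := q) (η := fun i j => P i j - M i j)
    (fun i j => by rw [hP, hM, edgeMatrix_comm E cp, edgeMatrix_comm E cm])
    (fun i => by rw [hP, hM, hdiag, hdiag, sub_zero]) hPMω hθ (by linarith) hβ
  have hexp : Real.exp (-(5 * L)) = 1 / n ^ 5 := by
    rw [Real.exp_neg, one_div]
    congr 1
    have : (5 : ℝ) * L = (5 : ℕ) * L := by norm_num
    rw [this, Real.exp_nat_mul, hL, Real.exp_log hn0]
  have c3 : bernoulliProb Finset.univ p (fun S => 8 * (n * Δ) / β ≤ S.card) ≤ 1 / n ^ 5 := by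
    refine (h.prob_card_le hp).trans ?_
    rw [← hexp, Real.exp_le_exp, neg_le_neg_iff, le_div_iff₀ (by positivity)]
    have h1 : Δ ^ 2 * ε ≤ n * Δ := by
      have := h.le_card
      nlinarith
    have : 0 < L * β := by positivity
    linarith
  have c4 : bernoulliProb Finset.univ p (fun S => (S.card : ℝ) ≤ 32000 * L / 2) ≤ 1 / n ^ 5 := by
    refine (h.prob_le_card hn ?_).trans ?_
    · rw [← mul_div_assoc, le_div_iff₀ hβ0]
      have h1 : Δ ^ 2 * ε ≤ n * (ε * Δ) := by
        have := h.le_card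
        have : 0 < ε * Δ := by positivity
        nlinarith
      have : 0 < L * β := by positivity
      linarith
    · rw [← hexp, Real.exp_le_exp]
      linarith
  set G := maxLabelScore Λ E cp cm with hG
  obtain ⟨hG1, hG2, hG3⟩ := hlab E cp cm hE hcp hcm
  have hGpos : n * Δ ≤ 4 * G := by linarith
  have hnΔ : 0 < n * Δ := by positivity
  have hGq : 2 * maxLabelScore (Fin q) E cp cm =
      maxLabelForm 1 M 1 + maxLabelForm q (fun i j => P i j - M i j) 1 :=
    two_mul_maxLabelScore hE (by simp [hP]) (by simp [hM])
  have hnbound : 1 / n ^ 3 + (1 / n ^ 3 + (1 / n ^ 5 + 1 / n ^ 5)) + 4 * (1 / n ^ 4) ≤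
      1 / n ^ 2 := by
    have h5 : 5 ≤ n := by linarith
    have e3 : 1 / n ^ 3 ≤ 1 / n ^ 2 * (1 / 5) := by
      rw [pow_succ, ← one_div_mul_one_div]; gcongr
    have e4 : 1 / n ^ 4 ≤ 1 / n ^ 3 * (1 / 5) := by
      rw [pow_succ n 3, ← one_div_mul_one_div]; gcongr
    have e5 : 1 / n ^ 5 ≤ 1 / n ^ 4 * (1 / 5) := by
      rw [pow_succ n 4, ← one_div_mul_one_div]; gcongr
    have e2 : 0 < 1 / n ^ 2 := by positivity
    linarith
  refine le_trans ?_ (twoStageProb_ge (a := 1 / n ^ 3 + (1 / n ^ 3 + (1 / n ^ 5 + 1 / n ^ 5)))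
    (b := 4 * (1 / n ^ 4)) (good := fun S =>
      |maxLabelForm 1 M (inverseWeight p S) - maxLabelForm 1 M 1| ≤ ε / 2000 * n * Δ ∧
      |maxLabelForm q (fun i j => P i j - M i j) (inverseWeight p S) -
        maxLabelForm q (fun i j => P i j - M i j) 1| ≤ ε / 2000 * n * Δ ∧
      (S.card : ℝ) < 8 * (n * Δ) / β ∧ 32000 * L / 2 < S.card)
    h.prob_mem hpe01 (by positivity) ?_ ?_)
  · linarith
  · have hor := (bernoulliProb_or_le h.prob_mem _ _).trans (add_le_add c1
      ((bernoulliProb_or_le h.prob_mem _ _).trans (add_le_add c2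
      ((bernoulliProb_or_le h.prob_mem _ _).trans (add_le_add c3 c4)))))
    refine le_trans (bernoulliProb_mono h.prob_mem fun S _ => ?_) hor
    contrapose!
    exact fun h => h
  · rintro S ⟨g1, g2, g3, g4⟩
    set U := edgesWithin E S with hU
    have hUE : ∀ e ∈ U, ¬ e.IsDiag := fun e he => hE e (hmemE he)
    set H := maxLabelScore Λ U (fun e => vertexScale p Δ e * cp e)
      (fun e => vertexScale p Δ e * cm e) with hH
    obtain ⟨hH1, hH2, hH3⟩ := hlab U _ _ hUE (hcp' S) (hcm' S)
    have hHq : 2 * (Δ ^ 2 * maxLabelScore (Fin q) U (fun e => vertexScale p Δ e * cp e)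
        (fun e => vertexScale p Δ e * cm e)) = maxLabelForm 1 M (inverseWeight p S) +
          maxLabelForm q (fun i j => P i j - M i j) (inverseWeight p S) := by
      rw [← maxLabelScore_const_mul _ _ _ (by positivity)]
      exact two_mul_maxLabelScore hUE (edgeMatrix_vertexSample E S cp p hΔ0)
        (edgeMatrix_vertexSample E S cm p hΔ0)
    rw [abs_le] at g1 g2
    have herr : ε / 2000 * n * Δ ≤ ε / 500 * G := by
      have := mul_le_mul_of_nonneg_left hGpos hε.le
      nlinarith
    have hΔ2 : 0 < Δ ^ 2 := by positivity
    -- the error of vertex sampling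
    have hb1 : (1 - 3 * ε / 1000) * G ≤ Δ ^ 2 * H := by
      have := mul_le_mul_of_nonneg_left hH2 hΔ2.le
      linarith
    have hb2 : (1 - ε / 1000) * (Δ ^ 2 * H) ≤ (1 + ε / 500) * G := by
      have := mul_le_mul_of_nonneg_left hH1 hΔ2.le
      linarith
    have hHpos : 0 < H := by
      have h1 : 0 < (1 - 3 * ε / 1000) * G := by
        have : 0 < 1 - 3 * ε / 1000 := by linarith
        have : 0 < G := by linarith
        positivity
      exact (mul_pos_iff_of_pos_left hΔ2).1 (h1.trans_le hb1)
    have hWsum : ∑ e ∈ U, w S e =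
        ∑ e ∈ U, (vertexScale p Δ e * cp e + vertexScale p Δ e * cm e) :=
      Finset.sum_congr rfl (hw S)
    have hWpos : 0 < ∑ e ∈ U, w S e := by
      rw [hWsum]
      exact hHpos.trans_le (maxLabelScore_le_sum (hcp' S) (hcm' S))
    have key := bernoulliProb_edge_sampling (Λ := Λ) (S := S) (U := U)
      (fun e he => (mem_edgesWithin.1 he).2) (hcp' S) (hcm' S) (fun e he => by
        rcases hcc e (hmemE he) with h0 | h0
        · left; rw [h0, mul_zero]
        · right; rw [h0, mul_zero]) (hw S) rfl hWpos hε hε1 (hpe S) (by rw [hWsum]; exact hH3)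
    refine le_trans (bernoulliProb_mono (hpe01 S) fun F _ => ?_) (key.trans ?_)
    · contrapose
      rintro ⟨a1, a2, a3⟩
      refine ⟨withinFactor_of_stages hε hε1 (by linarith) hb1 hb2 ?_ ?_, ?_⟩
      · have := mul_le_mul_of_nonneg_left a1 hΔ2.le
        linarith
      · have := mul_le_mul_of_nonneg_left a2 hΔ2.le
        linarith
      · have hε2 : 0 < ε ^ 2 := by positivity
        have hε21 : ε ^ 2 ≤ 1 := pow_le_one₀ hε.le hε1.le
        have h1 : (S.card : ℝ) ≤ S.card / ε ^ 2 := by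
          rw [le_div_iff₀ hε2]
          nlinarith [Nat.cast_nonneg (α := ℝ) S.card]
        calc (S.card : ℝ) + F.card ≤ S.card / ε ^ 2 + 24 * S.card / ε ^ 2 := add_le_add h1 a3
          _ = 25 * S.card / ε ^ 2 := by ring
          _ ≤ 25 * (8 * (n * Δ) / β) / ε ^ 2 := by gcongr
          _ = _ := by field_simp; norm_num
    · have hexp4 : Real.exp (-(4 * L)) = 1 / n ^ 4 := by
        rw [Real.exp_neg, one_div]
        congr 1
        have : (4 : ℝ) * L = (4 : ℕ) * L := by norm_num
        rw [this, Real.exp_nat_mul, hL, Real.exp_log hn0]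
      rw [← hexp4]
      gcongr
      linarith

end TwoStage

/-! ### Maximum cuts and clusterings as labellings -/

section Translation

variable {V : Type*}

theorem WGraph.cutWeight_eq (H : WGraph V) (hH : ∀ e ∈ H.edges, ∀ v ∈ e, v ∈ H.verts)
    {A : Finset V} {x : V → Fin 2} (hx : ∀ v ∈ H.verts, v ∈ A ↔ x v = 1) :
    H.cutWeight A = labelScore H.edges (fun _ => 0) H.weight x := by
  classical
  unfold WGraph.cutWeight labelScore
  rw [Finset.sum_filter]
  refine Finset.sum_congr rfl fun e he => ?_
  have hv := hH e he
  induction e using Sym2.ind with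
  | h i j =>
    have hi := hv i (Sym2.mem_mk_left i j)
    have hj := hv j (Sym2.mem_mk_right i j)
    have hbin : ∀ a b : Fin 2, a = b ↔ (a = 1 ↔ b = 1) := by decide
    have hiff : (∃ a ∈ A, ∃ b ∈ H.verts \ A, s(i, j) = s(a, b)) ↔ ¬ x i = x j := by
      rw [hbin, ← hx i hi, ← hx j hj]
      constructor
      · rintro ⟨a, ha, b, hb, hab⟩
        have hb' := (Finset.mem_sdiff.1 hb).2
        rcases Sym2.eq_iff.1 hab with ⟨rfl, rfl⟩ | ⟨rfl, rfl⟩ <;> tauto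
      · intro h
        by_cases hiA : i ∈ A
        · exact ⟨i, hiA, j, Finset.mem_sdiff.2 ⟨hj, by tauto⟩, rfl⟩
        · exact ⟨j, by tauto, i, Finset.mem_sdiff.2 ⟨hi, hiA⟩, Sym2.eq_swap⟩
    rw [sameLabel_mk]
    by_cases h : x i = x j
    · rw [if_neg (by rw [hiff]; tauto), if_pos h]; ring
    · rw [if_pos (hiff.2 h), if_neg h]; ring

theorem WGraph.maxCut_eq [Fintype V] (H : WGraph V) (hH : ∀ e ∈ H.edges, ∀ v ∈ e, v ∈ H.verts) :
    H.maxCut = maxLabelScore (Fin 2) H.edges (fun _ => 0) H.weight := by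
  classical
  refine le_antisymm (Finset.sup'_le _ _ fun A hA => ?_) (ciSup_le fun x => ?_)
  · rw [H.cutWeight_eq hH (x := fun v => if v ∈ A then 1 else 0)
      fun v _ => by by_cases h : v ∈ A <;> simp [h]]
    exact labelScore_le_max _ _ _ _
  · rw [← H.cutWeight_eq hH (A := H.verts.filter fun v => x v = 1)
      fun v hv => by simp [hv]]
    exact Finset.le_sup' H.cutWeight (Finset.mem_powerset.2 (Finset.filter_subset _ _))

open scoped Classical in
theorem CCGraph.score_eq {Λ : Type*} (H : CCGraph V) (hH : ∀ e ∈ H.edges, ∀ v ∈ e, v ∈ H.verts)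
    (P : Finpartition H.verts) {x : V → Λ}
    (hx : ∀ i ∈ H.verts, ∀ j ∈ H.verts, (∃ c ∈ P.parts, i ∈ c ∧ j ∈ c) ↔ x i = x j) :
    H.score P = labelScore H.edges H.cPos H.cNeg x := by
  classical
  unfold CCGraph.score labelScore
  rw [← Finset.sum_add_distrib]
  refine Finset.sum_congr rfl fun e he => ?_
  have hv := hH e he
  have : CCGraph.sameCluster P e = sameLabel x e := by
    induction e using Sym2.ind with
    | h i j =>
      have h := hx i (hv i (Sym2.mem_mk_left i j)) j (hv j (Sym2.mem_mk_right i j))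
      rw [sameLabel_mk]
      unfold CCGraph.sameCluster
      congr 1
      rw [← h]
      simp
  rw [this]

theorem CCGraph.maxAgree_eq [Fintype V] [Nonempty V] (H : CCGraph V)
    (hH : ∀ e ∈ H.edges, ∀ v ∈ e, v ∈ H.verts) :
    H.maxAgree = maxLabelScore V H.edges H.cPos H.cNeg := by
  classical
  refine le_antisymm (Finset.sup'_le _ _ fun P _ => ?_) (ciSup_le fun x => ?_)
  · rw [H.score_eq hH P (x := fun v => P.part v) fun i hi j hj => by
      rw [← P.mem_part_iff_exists, P.mem_part_iff_part_eq_part hi hj]]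
    exact labelScore_le_max_self _ _ _ _
  · rw [← H.score_eq hH (Finpartition.ofSetSetoid (Setoid.ker x) H.verts) fun i hi j hj => by
      rw [← Finpartition.mem_part_iff_exists, Finpartition.mem_part_ofSetSetoid_iff_rel]
      simp only [hi, hj, true_and, Setoid.ker_def]
      exact eq_comm]
    exact Finset.le_sup' H.score (Finset.mem_univ _)

theorem twoStageProb_congr [Fintype V] {E : Finset (Sym2 V)} {p : V → ℝ}
    {pe : Finset V → Sym2 V → ℝ} {ev ev' : Finset V → Finset (Sym2 V) → Prop}
    (h : ∀ S, ∀ F ⊆ edgesWithin E S, ev S F ↔ ev' S F) :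
    twoStageProb E p pe ev = twoStageProb E p pe ev' := by
  unfold twoStageProb
  refine Finset.sum_congr rfl fun S _ => ?_
  congr 1
  refine Finset.sum_congr rfl fun F hF => ?_
  have := h S F (Finset.mem_powerset.1 hF)
  by_cases hev : ev S F
  · rw [if_pos hev, if_pos (this.1 hev)]
  · rw [if_neg hev, if_neg fun h' => hev (this.2 h')]

open scoped Classical in
/-- The importance scores give sampling probabilities as required by `IsSampling`, with the degrees
truncated from below at `ε * Δ` and with `β = Δ ^ 2 * α`. -/
theorem isSampling_of_importanceScore [Fintype V] {E : Finset (Sym2 V)}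
    (hE : ∀ e ∈ E, ¬ e.IsDiag) {w : Sym2 V → ℝ} (hw : ∀ e ∈ E, 0 ≤ w e ∧ w e ≤ 1) {d p : V → ℝ}
    {n Δ ε α : ℝ} (hn : n = Fintype.card V) (hn3 : 3 ≤ n)
    (hd : ∀ i, d i = ∑ e ∈ E.filter (fun e => i ∈ e), w e)
    (hΔ : Δ = (∑ i, d i) / n) (hΔ0 : 0 < Δ) (hε : 0 < ε) (hε1 : ε < 1) (hα : 0 < α)
    (hp : ∀ i, p i ≤ 1 ∧ importanceScore ε α Δ (d i) ≤ p i ∧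
      p i ≤ 2 * importanceScore ε α Δ (d i)) :
    IsSampling (edgeMatrix E w) (fun i => max (d i) (ε * Δ)) p n Δ ε (Δ ^ 2 * α) ∧
      (∀ i, p i ≤ 2 * (max (d i) (ε * Δ) / (Δ ^ 2 * α))) ∧ n * Δ = 2 * ∑ e ∈ E, w e := by
  have hn0 : 0 < n := by linarith
  have hsum : ∑ i, d i = n * Δ := by rw [hΔ]; field_simp
  have hm0 : ∀ i j, 0 ≤ edgeMatrix E w i j := fun i j => by
    unfold edgeMatrix
    split_ifs with h
    · exact (hw _ h).1
    · exact le_rfl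
  have hm1 : ∀ i j, edgeMatrix E w i j ≤ 1 := fun i j => by
    unfold edgeMatrix
    split_ifs with h
    · exact (hw _ h).2
    · exact zero_le_one
  have hdm : ∀ i, ∑ j, edgeMatrix E w i j = d i := fun i => by rw [hd, sum_edgeMatrix]
  have hd0 : ∀ i, 0 ≤ d i := fun i => by
    rw [← hdm]; exact Finset.sum_nonneg fun j _ => hm0 i j
  have hdn : ∀ i, d i ≤ n := fun i => by
    rw [← hdm, hn]
    refine (Finset.sum_le_card_nsmul _ _ 1 fun j _ => hm1 i j).trans ?_
    simp
  have hg : ∀ i, 0 < max (d i) (ε * Δ) := fun i => lt_max_of_lt_right (by positivity)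
  refine ⟨⟨hn, hn3, hΔ0, ?_, hε, hε1.le, by positivity, edgeMatrix_comm E w, hm0, hm1,
    fun i => by rw [hdm]; exact le_max_left _ _, fun i => le_max_right _ _, ?_, fun i => ?_,
    fun i => (hp i).1, fun i => ?_⟩, fun i => ?_, ?_⟩
  · rw [hΔ, div_le_iff₀ hn0]
    have := Finset.sum_le_card_nsmul Finset.univ d n fun i _ => hdn i
    rwa [Finset.card_univ, nsmul_eq_mul, ← hn] at this
  · have h1 : ∑ i, max (d i) (ε * Δ) ≤ ∑ i, (d i + ε * Δ) := Finset.sum_le_sum fun i _ =>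
      max_le (by have : 0 < ε * Δ := by positivity
                 linarith) (by linarith [hd0 i])
    refine h1.trans ?_
    rw [Finset.sum_add_distrib, hsum, Finset.sum_const, Finset.card_univ, nsmul_eq_mul, ← hn]
    have : n * (ε * Δ) ≤ n * (1 * Δ) := by gcongr
    linarith
  · refine lt_of_lt_of_le ?_ (hp i).2.1
    have := hg i
    exact lt_min one_pos (by positivity)
  · have h1 := (hp i).2.1
    unfold importanceScore at h1
    rcases min_le_iff.1 h1 with h2 | h2
    · exact Or.inl (le_antisymm (hp i).1 h2)
    · right
      rw [div_le_iff₀ (by positivity)] at h2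
      linarith
  · refine (hp i).2.2.trans ?_
    have : importanceScore ε α Δ (d i) ≤ max (d i) (ε * Δ) / (Δ ^ 2 * α) := min_le_right _ _
    linarith
  · rw [← hsum, ← sum_sum_ite_mem_edges hE, ← Finset.sum_congr rfl fun i _ => hdm i]
    rfl

theorem maxLabelScore_nonneg_of_half {Λ : Type*} {E : Finset (Sym2 V)} {cp cm : Sym2 V → ℝ}
    (hp : ∀ e ∈ E, 0 ≤ cp e) (hm : ∀ e ∈ E, 0 ≤ cm e)
    (h : (∑ e ∈ E, (cp e + cm e)) / 2 ≤ maxLabelScore Λ E cp cm) :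
    0 ≤ maxLabelScore Λ E cp cm := by
  have : 0 ≤ ∑ e ∈ E, (cp e + cm e) :=
    Finset.sum_nonneg fun e he => add_nonneg (hp e he) (hm e he)
  linarith

/-- About `1000 / ε` labels are almost as good as arbitrarily many. -/
theorem maxLabelScore_self_approx [Fintype V] [Nonempty V] {ε : ℝ} (hε : 0 < ε) {q : ℕ} [NeZero q]
    (hq : 1000 / ε ≤ q) (E : Finset (Sym2 V)) (cp cm : Sym2 V → ℝ) (hE : ∀ e ∈ E, ¬ e.IsDiag)
    (hp : ∀ e ∈ E, 0 ≤ cp e) (hm : ∀ e ∈ E, 0 ≤ cm e) :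
    (1 - ε / 1000) * maxLabelScore V E cp cm ≤ maxLabelScore (Fin q) E cp cm ∧
      maxLabelScore (Fin q) E cp cm ≤ maxLabelScore V E cp cm ∧
      (∑ e ∈ E, (cp e + cm e)) / 2 ≤ maxLabelScore V E cp cm := by
  have hhalf : (∑ e ∈ E, (cp e + cm e)) / 2 ≤ maxLabelScore V E cp cm :=
    (half_sum_le_max_fin_two hE cp cm).trans
      (ciSup_le fun x => labelScore_le_max_self E cp cm x)
  refine ⟨?_, ciSup_le fun x => labelScore_le_max_self E cp cm x, hhalf⟩
  obtain ⟨x, hx⟩ := exists_labelScore_eq_max (Λ := V) E cp cm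
  have h0 := maxLabelScore_nonneg_of_half hp hm hhalf
  refine le_trans ?_ (labelScore_le_max_fin q hp x)
  rw [hx]
  have h1 : 1 / (q : ℝ) ≤ ε / 1000 := by
    have hq0 : (0 : ℝ) < q := lt_of_lt_of_le (by positivity) hq
    rw [div_le_iff₀ hε] at hq
    rw [div_le_iff₀ hq0]
    linarith
  gcongr

theorem exists_nat_log_le : ∃ n₀ : ℕ, ∀ n : ℕ, n₀ ≤ n → 3 ≤ n ∧ 32000 * Real.log n ≤ n := by
  have h := (Real.isLittleO_log_id_atTop.comp_tendsto tendsto_natCast_atTop_atTop).bound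
    (show (0 : ℝ) < 1 / 32000 by norm_num)
  obtain ⟨n₀, hn₀⟩ := Filter.eventually_atTop.1 h
  refine ⟨max n₀ 3, fun n hn => ⟨(le_max_right _ _).trans hn, ?_⟩⟩
  have h1 := hn₀ n ((le_max_left _ _).trans hn)
  simp only [Function.comp_apply, id, Real.norm_eq_abs, Nat.abs_cast] at h1
  have := le_abs_self (Real.log n)
  linarith

end Translation

theorem theorem4p3 :
    ∃ C : ℝ, 0 < C ∧ ∃ K : ℝ, 0 < K ∧ ∃ n₀ : ℕ,
      -- maximum cut
      (∀ (n : ℕ) (δ ε : ℝ) (G : SimpleGraph (Fin n)) (p : Fin n → ℝ) (Δ : ℝ),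
        n₀ ≤ n → 0 < δ → 0 < ε → ε < 1 →
        Δ = (WGraph.ofSimpleGraph G).avgDegree → Δ = (n : ℝ) ^ δ →
        (∀ i, p i ≤ 1 ∧
          importanceScore ε (ε ^ 4 / (C * Real.log n)) Δ ((WGraph.ofSimpleGraph G).degree i) ≤ p i ∧
          p i ≤ 2 * importanceScore ε (ε ^ 4 / (C * Real.log n)) Δ
            ((WGraph.ofSimpleGraph G).degree i)) →
        (n : ℝ) / Δ = (n : ℝ) ^ (1 - δ) ∧
        1 - 1 / (n : ℝ) ^ 2 ≤ (WGraph.ofSimpleGraph G).sampleProb p ε fun H' =>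
          WGraph.IsCoreSet ε (WGraph.ofSimpleGraph G) H' ∧
          (H'.size : ℝ) ≤ K / ε ^ 6 * Real.log n * (n / Δ)) ∧
      -- correlation clustering
      (∀ (n : ℕ) (δ ε : ℝ) (G : SimpleGraph (Fin n)) (cPos cNeg : Sym2 (Fin n) → ℝ)
        (p : Fin n → ℝ) (Δ : ℝ),
        n₀ ≤ n → 0 < δ → 0 < ε → ε < 1 →
        (∀ e ∈ G.edgeSet, 0 ≤ cPos e ∧ cPos e ≤ 1 ∧ 0 ≤ cNeg e ∧ cNeg e ≤ 1 ∧
          (cPos e = 0 ∨ cNeg e = 0)) →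
        Δ = (CCGraph.ofSimpleGraph G cPos cNeg).absGraph.avgDegree → Δ = (n : ℝ) ^ δ →
        (∀ i, p i ≤ 1 ∧
          importanceScore ε (ε ^ 8 / (C * Real.log n)) Δ
            ((CCGraph.ofSimpleGraph G cPos cNeg).absGraph.degree i) ≤ p i ∧
          p i ≤ 2 * importanceScore ε (ε ^ 8 / (C * Real.log n)) Δ
            ((CCGraph.ofSimpleGraph G cPos cNeg).absGraph.degree i)) →
        (n : ℝ) / Δ = (n : ℝ) ^ (1 - δ) ∧
        1 - 1 / (n : ℝ) ^ 2 ≤ (CCGraph.ofSimpleGraph G cPos cNeg).sampleProb p ε fun H' =>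
          CCGraph.IsCoreSet ε (CCGraph.ofSimpleGraph G cPos cNeg) H' ∧
          (H'.size : ℝ) ≤ K / ε ^ 10 * Real.log n * (n / Δ)) := by
  classical
  obtain ⟨n₀, hn₀⟩ := exists_nat_log_le
  -- `C = 10 ^ 26` meets the condition of `twoStageProb_maxLabelScore` on `β = Δ ^ 2 * α`, even
  -- with `q ≤ 1001 / ε` labels; `K = 200 * C` is then its size bound `200 * (n * Δ) / (β * ε ^ 2)`
  refine ⟨10 ^ 26, by norm_num, 200 * 10 ^ 26, by norm_num, n₀, ?_, ?_⟩
  · intro n δ ε G p Δ hn _ hε hε1 hΔ hΔδ hp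
    obtain ⟨hn3, hnlog⟩ := hn₀ n hn
    have hn3' : (3 : ℝ) ≤ n := by exact_mod_cast hn3
    have hn0 : (0 : ℝ) < n := by linarith
    have hL : 0 < Real.log n := Real.log_pos (by linarith)
    have hΔ0 : 0 < Δ := hΔδ ▸ Real.rpow_pos_of_pos hn0 δ
    refine ⟨by rw [hΔδ, Real.rpow_sub hn0, Real.rpow_one], ?_⟩
    set E := (WGraph.ofSimpleGraph G).edges with hE
    have hmem : ∀ e ∈ E, e ∈ G.edgeSet := fun e he => (Finset.mem_filter.1 he).2
    have hdiag : ∀ e ∈ E, ¬ e.IsDiag := fun e he => G.not_isDiag_of_mem_edgeSet (hmem e he)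
    have hn' : (n : ℝ) = Fintype.card (Fin n) := by simp
    obtain ⟨hs, hp2, hsum⟩ := isSampling_of_importanceScore hdiag (w := fun _ => (0 : ℝ) + 1)
      (d := (WGraph.ofSimpleGraph G).degree) (fun e _ => by norm_num) hn' hn3' (fun i => by
        simp only [zero_add]; rfl) (by
          rw [hΔ, WGraph.avgDegree]; simp [WGraph.ofSimpleGraph]) hΔ0 hε hε1 (by positivity) hp
    have key := twoStageProb_maxLabelScore (Λ := Fin 2) (q := 2) hdiag (cp := fun _ => 0)
      (cm := fun _ => 1) (fun _ _ => le_rfl) (fun _ _ => zero_le_one) (fun _ _ => Or.inl rfl)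
      hs hε1 hp2 hsum hnlog (by
        have : 10 ^ 6 * ((2 : ℕ) : ℝ) ^ 2 * Real.log n *
            (Δ ^ 2 * (ε ^ 4 / (10 ^ 26 * Real.log n))) = 4 / 10 ^ 20 * (Δ ^ 2 * ε ^ 4) := by
          field_simp; norm_num
        rw [this]
        have : 0 < Δ ^ 2 * ε ^ 4 := by positivity
        have h2 : Δ ^ 2 * (ε / 2000) ^ 4 = 1 / 2000 ^ 4 * (Δ ^ 2 * ε ^ 4) := by ring
        rw [h2]
        linarith)
      (fun E' cp' cm' h1 h2 h3 => by
        have hhalf := half_sum_le_max_fin_two h1 cp' cm'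
        have h0 := maxLabelScore_nonneg_of_half h2 h3 hhalf
        refine ⟨?_, le_rfl, hhalf⟩
        nlinarith)
      (w := fun S => ((WGraph.ofSimpleGraph G).vertexSample p S).weight)
      (pe := fun S => ((WGraph.ofSimpleGraph G).vertexSample p S).edgeProb ε)
      (fun S e _ => by
        simp only [WGraph.vertexSample, WGraph.ofSimpleGraph, mul_zero, zero_add, hΔ])
      (fun S e => rfl)
    refine key.trans (le_of_eq (twoStageProb_congr fun S F hF => ?_))
    have hF' : ∀ e ∈ F, ∀ v ∈ e, v ∈ S := fun e he => (mem_edgesWithin.1 (hF he)).2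
    have hmc : (((WGraph.ofSimpleGraph G).vertexSample p S).edgeSample ε F).maxCut =
        maxLabelScore (Fin 2) F (fun e => vertexScale p Δ e * 0 /
          ((WGraph.ofSimpleGraph G).vertexSample p S).edgeProb ε e) (fun e =>
          vertexScale p Δ e * 1 / ((WGraph.ofSimpleGraph G).vertexSample p S).edgeProb ε e) := by
      rw [WGraph.maxCut_eq _ hF', hΔ]
      simp only [mul_zero, zero_div]
      rfl
    have hmG : (WGraph.ofSimpleGraph G).maxCut =
        maxLabelScore (Fin 2) E (fun _ => 0) (fun _ => 1) :=
      WGraph.maxCut_eq _ fun _ _ _ _ => Finset.mem_univ _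
    unfold WGraph.IsCoreSet
    beta_reduce
    rw [hmc, hmG, ← hΔ]
    refine and_congr Iff.rfl (iff_of_eq ?_)
    have h1 : ((((WGraph.ofSimpleGraph G).vertexSample p S).edgeSample ε F).size : ℝ) =
        S.card + F.card := by
      unfold WGraph.size; push_cast; rfl
    rw [h1]
    congr 1
    field_simp
  · intro n δ ε G cPos cNeg p Δ hn _ hε hε1 hc hΔ hΔδ hp
    obtain ⟨hn3, hnlog⟩ := hn₀ n hn
    have hn3' : (3 : ℝ) ≤ n := by exact_mod_cast hn3
    have hn0 : (0 : ℝ) < n := by linarith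
    have : Nonempty (Fin n) := ⟨⟨0, by omega⟩⟩
    have hL : 0 < Real.log n := Real.log_pos (by linarith)
    have hΔ0 : 0 < Δ := hΔδ ▸ Real.rpow_pos_of_pos hn0 δ
    refine ⟨by rw [hΔδ, Real.rpow_sub hn0, Real.rpow_one], ?_⟩
    set E := (CCGraph.ofSimpleGraph G cPos cNeg).edges with hE
    have hmem : ∀ e ∈ E, e ∈ G.edgeSet := fun e he => (Finset.mem_filter.1 he).2
    have hdiag : ∀ e ∈ E, ¬ e.IsDiag := fun e he => G.not_isDiag_of_mem_edgeSet (hmem e he)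
    have habs : ∀ e ∈ E, |cPos e - cNeg e| = cPos e + cNeg e := fun e he => by
      obtain ⟨h1, _, h2, _, h3 | h3⟩ := hc e (hmem e he)
      · rw [h3, zero_sub, abs_neg, abs_of_nonneg h2, zero_add]
      · rw [h3, sub_zero, add_zero, abs_of_nonneg h1]
    have hdeg : ∀ i, (CCGraph.ofSimpleGraph G cPos cNeg).absGraph.degree i =
        ∑ e ∈ E.filter (fun e => i ∈ e), (cPos e + cNeg e) := fun i =>
      Finset.sum_congr (by congr!) fun e he => habs e (Finset.mem_filter.1 he).1
    have hn' : (n : ℝ) = Fintype.card (Fin n) := by simp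
    obtain ⟨hs, hp2, hsum⟩ := isSampling_of_importanceScore hdiag (w := fun e => cPos e + cNeg e)
      (d := (CCGraph.ofSimpleGraph G cPos cNeg).absGraph.degree) (fun e he => by
        obtain ⟨h1, h1', h2, h2', h3 | h3⟩ := hc e (hmem e he) <;> rw [h3] <;>
        constructor <;> linarith) hn' hn3' (fun i => by
        rw [hdeg]; congr!) (by
          rw [hΔ, WGraph.avgDegree]; simp [CCGraph.ofSimpleGraph, CCGraph.absGraph]) hΔ0 hε hε1
      (by positivity) hp
    have hvs : ∀ e, 0 < vertexScale p (CCGraph.ofSimpleGraph G cPos cNeg).absGraph.avgDegree e :=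
      vertexScale_pos hs.prob_pos (hΔ ▸ hΔ0)
    -- the number of labels that are as good as arbitrarily many
    set q : ℕ := ⌈1000 / ε⌉₊ with hq
    have hqpos : 0 < q := Nat.ceil_pos.2 (by positivity)
    have : NeZero q := ⟨hqpos.ne'⟩
    have hq1 : 1000 / ε ≤ q := Nat.le_ceil _
    have hq2 : (q : ℝ) ≤ 1001 / ε := by
      have h1 : (q : ℝ) < 1000 / ε + 1 := Nat.ceil_lt_add_one (by positivity)
      have h2 : 1 ≤ 1 / ε := by rw [le_div_iff₀ hε]; linarith
      have h3 : 1001 / ε = 1000 / ε + 1 / ε := by ring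
      linarith
    have key := twoStageProb_maxLabelScore (Λ := Fin n) (q := q) hdiag (cp := cPos)
      (cm := cNeg) (fun e he => (hc e (hmem e he)).1) (fun e he => (hc e (hmem e he)).2.2.1)
      (fun e he => (hc e (hmem e he)).2.2.2.2)
      hs hε1 hp2 hsum hnlog (by
        have h1 : 10 ^ 6 * (q : ℝ) ^ 2 * Real.log n *
            (Δ ^ 2 * (ε ^ 8 / (10 ^ 26 * Real.log n))) =
            (q : ℝ) ^ 2 * (1 / 10 ^ 20 * (Δ ^ 2 * ε ^ 8)) := by
          field_simp
        have h2 : Δ ^ 2 * (ε / 2000) ^ 4 = 1 / 2000 ^ 4 * (Δ ^ 2 * ε ^ 4) := by ring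
        rw [h1, h2]
        calc (q : ℝ) ^ 2 * (1 / 10 ^ 20 * (Δ ^ 2 * ε ^ 8))
            ≤ (1001 / ε) ^ 2 * (1 / 10 ^ 20 * (Δ ^ 2 * ε ^ 8)) := by gcongr
          _ = 1001 ^ 2 / 10 ^ 20 * (Δ ^ 2 * ε ^ 6) := by field_simp
          _ ≤ 1 / 2000 ^ 4 * (Δ ^ 2 * ε ^ 4) := by
            have h3 : ε ^ 6 ≤ ε ^ 4 := pow_le_pow_of_le_one hε.le hε1.le (by norm_num)
            exact mul_le_mul (by norm_num) (by gcongr) (by positivity) (by positivity))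
      (maxLabelScore_self_approx hε hq1)
      (w := fun S => ((CCGraph.ofSimpleGraph G cPos cNeg).vertexSample p S).absGraph.weight)
      (pe := fun S => ((CCGraph.ofSimpleGraph G cPos cNeg).vertexSample p S).absGraph.edgeProb ε)
      (fun S e he => by
        have h1 := habs e (mem_edgesWithin.1 he).1
        change |vertexScale p (CCGraph.ofSimpleGraph G cPos cNeg).absGraph.avgDegree e * cPos e -
          vertexScale p (CCGraph.ofSimpleGraph G cPos cNeg).absGraph.avgDegree e * cNeg e| = _
        rw [← mul_sub, abs_mul, abs_of_pos (hvs e), h1, ← hΔ, mul_add])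
      (fun S e => rfl)
    refine key.trans (le_of_eq (twoStageProb_congr fun S F hF => ?_))
    have hF' : ∀ e ∈ F, ∀ v ∈ e, v ∈ S := fun e he => (mem_edgesWithin.1 (hF he)).2
    have hmc : (((CCGraph.ofSimpleGraph G cPos cNeg).vertexSample p S).edgeSample ε F).maxAgree =
        maxLabelScore (Fin n) F (fun e => vertexScale p Δ e * cPos e /
          ((CCGraph.ofSimpleGraph G cPos cNeg).vertexSample p S).absGraph.edgeProb ε e) (fun e =>
          vertexScale p Δ e * cNeg e /
          ((CCGraph.ofSimpleGraph G cPos cNeg).vertexSample p S).absGraph.edgeProb ε e) := by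
      rw [CCGraph.maxAgree_eq _ hF', hΔ]
      rfl
    have hmG : (CCGraph.ofSimpleGraph G cPos cNeg).maxAgree =
        maxLabelScore (Fin n) E cPos cNeg :=
      CCGraph.maxAgree_eq _ fun _ _ _ _ => Finset.mem_univ _
    unfold CCGraph.IsCoreSet
    beta_reduce
    rw [hmc, hmG, ← hΔ]
    refine and_congr Iff.rfl (iff_of_eq ?_)
    have h1 : ((((CCGraph.ofSimpleGraph G cPos cNeg).vertexSample p S).edgeSample ε F).size : ℝ) =
        S.card + F.card := by
      unfold CCGraph.size; push_cast; rfl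
    rw [h1]
    congr 1
    field_simp
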